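/- **Theorem (Central limit of barycentric refinements).** For a finite simple graph $G$ let $G_1$ be its barycentric refinement: the vertices of $G_1$ are the nonempty complete subgraphs of $G$, and two different ones are adjacent if one is contained in the other. Let $G_0=G$ and let $G_{m+1}=(G_m)_1$ be the successive barycentric refinements. For a graph $H$ with $n\ge 1$ vertices let $\lambda_0\le\lambda_1\le\dots\le\lambda_{n-1}$ be the eigenvalues, with multiplicity, of its Laplacian (degree matrix minus adjacency matrix), and let $F_H(x)=\lambda_{[nx]}$ for $x\in[0,1)$ and $F_H(1)=\lambda_{n-1}$, where $[\cdot]$ is the floor function. For every integer $d\ge 0$ there are a function $F_d\in L^1([0,1])$, increasing on $[0,1)$ with $F_d(0)=0$, and a number $\rho_d\in(0,1)$ such that for every finite simple graph $G$ whose largest complete subgraph has dimension $d$ (that is, has $d+1$ vertices): 1. $F_{G_m}\to F_d$ in $L^1([0,1])$ as $m\to\infty$; in particular the limit depends only on $d$. 2. The convergence is exponentially fast: there is a constant $C$ (depending on $G$) with $\|F_{G_m}-F_d\|_{L^1([0,1])}\le C\rho_d^m$ for all $m\ge 0$. 3. $F_{G_m}\to F_d$ uniformly on every compact set $K\subset[0,1)$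 such that $F_d$, as a function on $[0,1)$, is continuous at every point of $K$. 4. If $0<a'<a\le b<b'<1$ and $F_d$ is Hölder continuous on $[a',b']$ (with some exponent $\alpha>0$), then there are $C$ and $\sigma\in(0,1)$ with $\sup_{x\in[a,b]}|F_{G_m}(x)-F_d(x)|\le C\sigma^m$ for all $m\ge 0$. -/

import Mathlib

open MeasureTheory Filter Topology Set
open scoped ENNReal NNReal

universe u

/-- A finite simple graph, bundled with its vertex type, so that the refinement process, which
changes the vertex type in every step, can be iterated. -/
structure FiniteGraph : Type (u + 1) where
  /-- the vertices -/
  V : Type u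
  /-- there are finitely many vertices -/
  fintypeV : Fintype V
  /-- the graph itself -/
  graph : SimpleGraph V

namespace FiniteGraph

attribute [instance] FiniteGraph.fintypeV

/-- The vertices of the barycentric refinement: the nonempty complete subgraphs (cliques),
given by their vertex sets. -/
def Simplex (G : FiniteGraph.{u}) : Type u :=
  {s : Finset G.V // s.Nonempty ∧ G.graph.IsClique (s : Set G.V)}

noncomputable instance (G : FiniteGraph.{u}) : Fintype G.Simplex := by
  classical
  unfold Simplex
  exact Fintype.ofFinite _

/-- The barycentric refinement: two different complete subgraphs are adjacent if one of them is
contained in the other. -/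
noncomputable def refine (G : FiniteGraph.{u}) : FiniteGraph.{u} where
  V := G.Simplex
  fintypeV := inferInstance
  graph :=
    { Adj := fun s t => s ≠ t ∧ (s.1 ⊆ t.1 ∨ t.1 ⊆ s.1)
      symm := ⟨fun _ _ h => ⟨h.1.symm, h.2.symm⟩⟩
      loopless := ⟨fun _ h => h.1 rfl⟩ }

/-- The `m`-th successive barycentric refinement `G_m`, with `G_0 = G`. -/
noncomputable def iterRefine (G : FiniteGraph.{u}) (m : ℕ) : FiniteGraph.{u} :=
  refine^[m] G

/-- The number of vertices. -/
def order (G : FiniteGraph.{u}) : ℕ := Fintype.card G.V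

open Classical in
/-- The eigenvalue `λ_k` of the Laplacian (degree matrix minus adjacency matrix), where the
eigenvalues are listed with multiplicity in increasing order `λ_0 ≤ λ_1 ≤ ⋯ ≤ λ_{n-1}`.
(Mathlib's `eigenvalues₀` lists them in decreasing order.) It is `0` for `k ≥ n`. -/
noncomputable def laplaceEigenvalue (G : FiniteGraph.{u}) (k : ℕ) : ℝ :=
  if h : k < Fintype.card G.V then
    (SimpleGraph.isHermitian_lapMatrix ℝ G.graph).eigenvalues₀ (Fin.rev ⟨k, h⟩)
  else 0

/-- The spectral function `F_G(x) = λ_{[n x]}` on `[0,1]`, where `n` is the number of vertices.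
At the endpoint `x = 1` the value is the largest eigenvalue `λ_{n-1}`. -/
noncomputable def spectralFunction (G : FiniteGraph.{u}) (x : ℝ) : ℝ :=
  G.laplaceEigenvalue (min ⌊(G.order : ℝ) * x⌋₊ (G.order - 1))

end FiniteGraph

-- Every vertex of $G_m$ has a carrier, the smallest simplex of $G$ containing it; call the vertex
-- interior if its carrier has $d+1$ vertices. Adjacent interior vertices have equal carriers
-- (`carrier_eq_of_adj`). Hence deleting all edges with a non-interior endpoint splits $G_m$ into
-- one copy of the universal graph `interior d m` for each $d$-simplex of $G$, plus isolated
-- vertices.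
--
-- Both changes are monotone for the spectrum: deleting edges shrinks the quadratic form of the
-- Laplacian, and isolated vertices only add zero eigenvalues. The $L^1$ distance of two ordered
-- functions is the difference of their integrals, and by the trace $\int F_H = 2|E|/n$. So the
-- $L^1$ error is controlled by counting edges and vertices (`eLpNorm_spectralFunction_sub_le`).
--
-- For the counts, a simplex of the refinement is a chain of simplices, and a simplex with $k$
-- vertices is the top of $k!$ chains of full length $k$. Thus $G_m$ has at least $(d+1)!^m$
-- simplices with $d+1$ vertices. After one refinement each simplex has a vertex with the same
-- carrier as the whole simplex, so a $d$-simplex has at most $d$ boundary vertices, and at most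
-- $d\cdot d!$ of its full chains start at one of them. Weighting simplices by $M^{\mathrm{card}}$
-- with $M$ large makes the shorter chains cost only $1/4$ in the growth factor
-- (`boundaryWeight_refine_le`). As $d\cdot d!<(d+1)!$, the boundary is exponentially negligible.
--
-- Used for the $d$-simplex and for its refinement, this compares consecutive interiors with one
-- common graph, so their spectral functions are Cauchy in $L^1$; the limit is $F_d$, and it
-- attracts every $G$. The pointwise statements follow because a monotone function is squeezed
-- between its averages over short intervals to the left and to the right.

local notation "μ₁" => (volume.restrict (Icc (0 : ℝ) 1) : Measure ℝ)

/-! ### Monotone functions: from `L¹` bounds to pointwise bounds -/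

theorem MonotoneOn.aestronglyMeasurable_unit {f : ℝ → ℝ} (hf : MonotoneOn f (Icc 0 1)) :
    AEStronglyMeasurable f μ₁ :=
  (aemeasurable_restrict_of_monotoneOn measurableSet_Icc hf).aestronglyMeasurable

theorem MonotoneOn.memLp_unit {f : ℝ → ℝ} (hf : MonotoneOn f (Icc 0 1)) : MemLp f 1 μ₁ := by
  rw [memLp_one_iff_integrable]
  exact hf.integrableOn_isCompact isCompact_Icc

/-- An `L¹` bound controls the difference of the integrals over a subinterval. -/
theorem abs_setIntegral_sub_le {f F : ℝ → ℝ} (hf : MemLp f 1 μ₁) (hF : MemLp F 1 μ₁) {D : ℝ}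
    (hD : 0 ≤ D) (h : eLpNorm (f - F) 1 μ₁ ≤ ENNReal.ofReal D) {a b : ℝ} (ha : 0 ≤ a)
    (hab : a ≤ b) (hb : b ≤ 1) :
    |(∫ x in a..b, f x) - ∫ x in a..b, F x| ≤ D := by
  have hs : Ioc a b ⊆ Icc (0 : ℝ) 1 := fun x hx => ⟨ha.trans hx.1.le, hx.2.trans hb⟩
  have hle : volume.restrict (Ioc a b) ≤ μ₁ := Measure.restrict_mono hs le_rfl
  have hfi := memLp_one_iff_integrable.1 (hf.mono_measure hle)
  have hFi := memLp_one_iff_integrable.1 (hF.mono_measure hle)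
  rw [intervalIntegral.integral_of_le hab, intervalIntegral.integral_of_le hab,
    ← integral_sub hfi hFi]
  have h2 : eLpNorm (f - F) 1 (volume.restrict (Ioc a b)) ≤ ENNReal.ofReal D :=
    (eLpNorm_mono_measure _ hle).trans h
  rw [eLpNorm_one_eq_lintegral_enorm] at h2
  have h3 := ofReal_integral_norm_eq_lintegral_enorm (hfi.sub hFi)
  have h4 : ∫ x in Ioc a b, ‖(f - F) x‖ ≤ D := by
    rw [← ENNReal.ofReal_le_ofReal_iff hD, h3]
    exact h2
  exact (norm_integral_le_integral_norm (fun x => f x - F x)).trans h4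

/-- By monotonicity `f x` is at most the mean of `f` over the window of length `δ` to its right, and
this mean differs from that of `F` by at most `D / δ`. The next lemma uses the window to the left.
-/
theorem MonotoneOn.le_of_eLpNorm_sub_le {f F : ℝ → ℝ} (hm : MonotoneOn f (Icc 0 1))
    (hF : MemLp F 1 μ₁) {D : ℝ} (hD : 0 ≤ D) (h : eLpNorm (f - F) 1 μ₁ ≤ ENNReal.ofReal D)
    {x δ c : ℝ} (hx : 0 ≤ x) (hδ : 0 < δ) (hx1 : x + δ ≤ 1)
    (hc : ∀ y ∈ Ioo x (x + δ), F y ≤ c) : f x ≤ c + D / δ := by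
  have h1 := abs_setIntegral_sub_le hm.memLp_unit hF hD h hx (by linarith : x ≤ x + δ) hx1
  have hs : uIcc x (x + δ) ⊆ Icc (0 : ℝ) 1 := by
    rw [uIcc_of_le (by linarith)]
    exact Icc_subset_Icc hx hx1
  have hle : volume.restrict (Icc x (x + δ)) ≤ μ₁ :=
    Measure.restrict_mono (Icc_subset_Icc hx hx1) le_rfl
  have hfi : IntervalIntegrable f volume x (x + δ) :=
    (intervalIntegrable_iff_integrableOn_Icc_of_le (by linarith)).2
      (memLp_one_iff_integrable.1 (hm.memLp_unit.mono_measure hle))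
  have hFi : IntervalIntegrable F volume x (x + δ) :=
    (intervalIntegrable_iff_integrableOn_Icc_of_le (by linarith)).2
      (memLp_one_iff_integrable.1 (hF.mono_measure hle))
  have h2 : f x * δ ≤ ∫ y in x..(x + δ), f y := by
    have := intervalIntegral.integral_mono_on_of_le_Ioo (by linarith : x ≤ x + δ)
      (intervalIntegrable_const (c := f x)) hfi
      (fun y hy => hm ⟨hx, by linarith⟩ ⟨hx.trans hy.1.le, hy.2.le.trans hx1⟩ hy.1.le)
    rw [intervalIntegral.integral_const, smul_eq_mul] at this
    linarith [this]
  have h3 : ∫ y in x..(x + δ), F y ≤ c * δ := by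
    have := intervalIntegral.integral_mono_on_of_le_Ioo (by linarith : x ≤ x + δ) hFi
      (intervalIntegrable_const (c := c)) hc
    rw [intervalIntegral.integral_const, smul_eq_mul] at this
    linarith [this]
  have h4 : f x * δ ≤ (c + D / δ) * δ := by
    rw [add_mul, div_mul_cancel₀ _ hδ.ne']
    linarith [(abs_le.1 h1).2]
  exact le_of_mul_le_mul_right h4 hδ

theorem MonotoneOn.ge_of_eLpNorm_sub_le {f F : ℝ → ℝ} (hm : MonotoneOn f (Icc 0 1))
    (hF : MemLp F 1 μ₁) {D : ℝ} (hD : 0 ≤ D) (h : eLpNorm (f - F) 1 μ₁ ≤ ENNReal.ofReal D)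
    {x δ c : ℝ} (hx : 0 ≤ x - δ) (hδ : 0 < δ) (hx1 : x ≤ 1)
    (hc : ∀ y ∈ Ioo (x - δ) x, c ≤ F y) : c - D / δ ≤ f x := by
  have h1 := abs_setIntegral_sub_le hm.memLp_unit hF hD h hx (by linarith : x - δ ≤ x) hx1
  have hle : volume.restrict (Icc (x - δ) x) ≤ μ₁ :=
    Measure.restrict_mono (Icc_subset_Icc hx hx1) le_rfl
  have hfi : IntervalIntegrable f volume (x - δ) x :=
    (intervalIntegrable_iff_integrableOn_Icc_of_le (by linarith)).2
      (memLp_one_iff_integrable.1 (hm.memLp_unit.mono_measure hle))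
  have hFi : IntervalIntegrable F volume (x - δ) x :=
    (intervalIntegrable_iff_integrableOn_Icc_of_le (by linarith)).2
      (memLp_one_iff_integrable.1 (hF.mono_measure hle))
  have h2 : ∫ y in (x - δ)..x, f y ≤ f x * δ := by
    have := intervalIntegral.integral_mono_on_of_le_Ioo (by linarith : x - δ ≤ x) hfi
      (intervalIntegrable_const (c := f x))
      (fun y hy => hm ⟨hx.trans hy.1.le, hy.2.le.trans hx1⟩ ⟨by linarith, hx1⟩ hy.2.le)
    rw [intervalIntegral.integral_const, smul_eq_mul] at this
    linarith [this]
  have h3 : c * δ ≤ ∫ y in (x - δ)..x, F y := by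
    have := intervalIntegral.integral_mono_on_of_le_Ioo (by linarith : x - δ ≤ x)
      (intervalIntegrable_const (c := c)) hFi hc
    rw [intervalIntegral.integral_const, smul_eq_mul] at this
    linarith [this]
  have h4 : (c - D / δ) * δ ≤ f x * δ := by
    rw [sub_mul, div_mul_cancel₀ _ hδ.ne']
    linarith [(abs_le.1 h1).1]
  exact le_of_mul_le_mul_right h4 hδ

/-- A sequence of monotone functions which converges geometrically in `L¹` has a limit which is
monotone away from the right endpoint. -/
theorem exists_monotoneOn_limit {f : ℕ → ℝ → ℝ} (hm : ∀ m, MonotoneOn (f m) (Icc 0 1))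
    (h0 : ∀ m, f m 0 = 0) {C ρ : ℝ} (hC : 0 ≤ C) (hρ : 0 ≤ ρ) (hρ1 : ρ < 1)
    (h : ∀ m, eLpNorm (f (m + 1) - f m) 1 μ₁ ≤ ENNReal.ofReal (C * ρ ^ m)) :
    ∃ F : ℝ → ℝ, MemLp F 1 μ₁ ∧ MonotoneOn F (Ico 0 1) ∧ F 0 = 0 ∧
      ∀ m, eLpNorm (f m - F) 1 μ₁ ≤ ENNReal.ofReal (C / (1 - ρ) * ρ ^ m) := by
  have hL : ∀ m, MemLp (f m) 1 μ₁ := fun m => (hm m).memLp_unit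
  let g : ℕ → Lp ℝ 1 μ₁ := fun m => (hL m).toLp (f m)
  have hd : ∀ m, dist (g m) (g (m + 1)) ≤ C * ρ ^ m := by
    intro m
    rw [dist_comm, dist_edist, Lp.edist_toLp_toLp]
    exact ENNReal.toReal_le_of_le_ofReal (by positivity) (h m)
  obtain ⟨G, hG⟩ := cauchySeq_tendsto_of_complete (cauchySeq_of_le_geometric ρ C hρ1 hd)
  have hGd := dist_le_of_le_geometric_of_tendsto ρ C hρ1 hd hG
  have hmeas : TendstoInMeasure μ₁ (fun m => (g m : ℝ → ℝ)) atTop (G : ℝ → ℝ) :=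
    tendstoInMeasure_of_tendsto_Lp hG
  obtain ⟨ns, hns, hae⟩ := hmeas.exists_seq_tendsto_ae
  -- A pointwise representative of the `L¹` limit: a lower limit inherits monotonicity and the value
  -- at `0` at every point, not only almost everywhere.
  let F : ℝ → ℝ := fun x => liminf (fun k => f (ns k) x) atTop
  have hFG : F =ᵐ[μ₁] G := by
    have h1 : ∀ᵐ x ∂μ₁, ∀ m, g m x = f m x := by
      rw [ae_all_iff]
      exact fun m => (hL m).coeFn_toLp
    filter_upwards [h1, hae] with x hx1 hx2
    simp only [hx1] at hx2
    exact hx2.liminf_eq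
  have hFL : MemLp F 1 μ₁ := (memLp_congr_ae hFG).2 (Lp.memLp G)
  have hbound : ∀ m, eLpNorm (f m - F) 1 μ₁ ≤ ENNReal.ofReal (C / (1 - ρ) * ρ ^ m) := by
    intro m
    have h2 : eLpNorm (f m - F) 1 μ₁ = edist (g m) G := by
      rw [Lp.edist_def]
      refine eLpNorm_congr_ae ?_
      filter_upwards [(hL m).coeFn_toLp, hFG] with x hx1 hx2
      simp [g, hx1, hx2]
    rw [h2, edist_dist]
    refine ENNReal.ofReal_le_ofReal ((hGd m).trans_eq ?_)
    ring
  have hnn : ∀ m, ∀ x ∈ Icc (0 : ℝ) 1, 0 ≤ f m x := by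
    intro m x hx
    rw [← h0 m]
    exact hm m ⟨le_rfl, zero_le_one⟩ hx hx.1
  -- Comparing real lower limits needs bounded sequences. The bound comes from the averaging lemma
  -- with limit function `0`; the window to the right of `x` has length `1 - x`, which excludes `x =
  -- 1`.
  have hub : ∀ x ∈ Ico (0 : ℝ) 1, ∃ c, ∀ m, f m x ≤ c := by
    intro x hx
    have hz : MemLp (0 : ℝ → ℝ) 1 μ₁ := MemLp.zero
    refine ⟨0 + ((eLpNorm F 1 μ₁).toReal + C / (1 - ρ)) / (1 - x), fun m => ?_⟩
    have h1r : (0 : ℝ) < 1 - ρ := by linarith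
    refine (hm m).le_of_eLpNorm_sub_le hz (by positivity) ?_ hx.1 (by linarith [hx.2])
      (by linarith) (by simp)
    rw [sub_zero, ENNReal.ofReal_add ENNReal.toReal_nonneg (by positivity),
      ENNReal.ofReal_toReal hFL.2.ne, add_comm]
    calc eLpNorm (f m) 1 μ₁ = eLpNorm ((f m - F) + F) 1 μ₁ := by rw [sub_add_cancel]
      _ ≤ eLpNorm (f m - F) 1 μ₁ + eLpNorm F 1 μ₁ :=
        eLpNorm_add_le ((hL m).sub hFL).1 hFL.1 le_rfl
      _ ≤ _ := by
        gcongr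
        refine (hbound m).trans (ENNReal.ofReal_le_ofReal ?_)
        exact mul_le_of_le_one_right (by positivity) (pow_le_one₀ hρ hρ1.le)
  refine ⟨F, hFL, ?_, ?_, hbound⟩
  · intro x hx y hy hxy
    obtain ⟨c, hc⟩ := hub y hy
    refine liminf_le_liminf (Eventually.of_forall fun k =>
      hm _ ⟨hx.1, hx.2.le⟩ ⟨hy.1, hy.2.le⟩ hxy) ?_ ?_
    · exact isBoundedUnder_of ⟨0, fun k => hnn _ x ⟨hx.1, hx.2.le⟩⟩
    · exact IsBoundedUnder.isCoboundedUnder_ge (isBoundedUnder_of ⟨c, fun k => hc _⟩)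
  · simp [F, h0]

theorem tendstoUniformlyOn_of_monotoneOn {f : ℕ → ℝ → ℝ} {F : ℝ → ℝ}
    (hm : ∀ m, MonotoneOn (f m) (Icc 0 1)) (h0 : ∀ m, f m 0 = 0) (hF : MemLp F 1 μ₁)
    (hF0 : F 0 = 0) {D : ℕ → ℝ} (hD : ∀ m, 0 ≤ D m)
    (hD0 : Tendsto D atTop (𝓝 0))
    (h : ∀ m, eLpNorm (f m - F) 1 μ₁ ≤ ENNReal.ofReal (D m)) {K : Set ℝ} (hK : IsCompact K)
    (hK1 : K ⊆ Ico 0 1) (hc : ∀ x ∈ K, ContinuousWithinAt F (Ico 0 1) x) :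
    TendstoUniformlyOn f F atTop K := by
  rw [← tendstoLocallyUniformlyOn_iff_tendstoUniformlyOn_of_compact hK]
  rw [Metric.tendstoLocallyUniformlyOn_iff]
  intro ε hε x hx
  obtain ⟨δ, hδ, hδc⟩ := Metric.continuousWithinAt_iff.1 (hc x hx) (ε / 4) (by positivity)
  obtain ⟨hx0, hx1⟩ := hK1 hx
  -- For `y` within `η` of `x`, windows of length `η` next to `y` stay within `δ` of `x` and to the
  -- left of `1`.
  let η := min (δ / 4) ((1 - x) / 4)
  have hη : 0 < η := lt_min (by positivity) (by linarith)
  have hη1 : η ≤ δ / 4 := min_le_left _ _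
  have hη2 : η ≤ (1 - x) / 4 := min_le_right _ _
  have hev : ∀ᶠ m in atTop, D m / η < ε / 4 := by
    have : Tendsto (fun m => D m / η) atTop (𝓝 0) := by simpa using hD0.div_const η
    exact this.eventually_lt_const (by positivity)
  have hval : ∀ y, 0 ≤ y → |y - x| < δ → y < 1 → |F y - F x| < ε / 4 := fun y hy0 hyx hy1 =>
    hδc ⟨hy0, hy1⟩ hyx
  refine ⟨Metric.ball x η ∩ K, inter_mem (mem_nhdsWithin_of_mem_nhds (Metric.ball_mem_nhds x hη))
    self_mem_nhdsWithin, ?_⟩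
  filter_upwards [hev] with m hmε
  rintro y ⟨hyx, hyK⟩
  obtain ⟨hy0, hy1⟩ := hK1 hyK
  rw [Metric.mem_ball, Real.dist_eq, abs_lt] at hyx
  have hFy := abs_lt.1 (hval y hy0 (abs_lt.2 ⟨by linarith, by linarith⟩) hy1)
  have hup : f m y ≤ (F x + ε / 4) + D m / η := by
    refine (hm m).le_of_eLpNorm_sub_le hF (hD m) (h m) hy0 hη (by linarith) fun z hz => ?_
    have := abs_lt.1 (hval z (by linarith [hz.1]) (abs_lt.2 ⟨by linarith [hz.1], by linarith [hz.2]⟩)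
      (by linarith [hz.2]))
    linarith
  have hlow : (F x - ε / 4) - D m / η ≤ f m y := by
    by_cases hyη : η ≤ y
    · refine (hm m).ge_of_eLpNorm_sub_le hF (hD m) (h m) (by linarith) hη hy1.le fun z hz => ?_
      have := abs_lt.1 (hval z (by linarith [hz.1])
        (abs_lt.2 ⟨by linarith [hz.1], by linarith [hz.2]⟩) (by linarith [hz.2]))
      linarith
    -- Near `0` there is no room for a window to the left; here `f m ≥ 0`, and `F x` is within `ε /
    -- 4` of `F 0 = 0`.
    · have hf0 : 0 ≤ f m y := by
        rw [← h0 m]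
        exact hm m ⟨le_rfl, zero_le_one⟩ ⟨hy0, hy1.le⟩ hy0
      have := abs_lt.1 (hval 0 le_rfl (abs_lt.2 ⟨by linarith, by linarith⟩) (by linarith))
      have h2 : 0 ≤ D m / η := div_nonneg (hD m) hη.le
      linarith
  rw [Real.dist_eq, abs_lt]
  constructor <;> linarith

/-- Average over windows of length `η * r ^ m` with `r = √ρ`. The `L¹` error divided by the window
length is of order `r ^ m`, and the Hölder oscillation of `F` in the window is of order `(r ^ α) ^
m`; so `σ = max r (r ^ α)` works. -/
theorem exists_geometric_bound_of_holderOnWith {f : ℕ → ℝ → ℝ} {F : ℝ → ℝ}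
    (hm : ∀ m, MonotoneOn (f m) (Icc 0 1)) (hF : MemLp F 1 μ₁) {C ρ : ℝ} (hC : 0 ≤ C)
    (hρ : 0 < ρ) (hρ1 : ρ < 1)
    (h : ∀ m, eLpNorm (f m - F) 1 μ₁ ≤ ENNReal.ofReal (C * ρ ^ m))
    {a' a b b' : ℝ} (ha' : 0 < a') (haa : a' < a) (hbb : b < b') (hb' : b' < 1)
    {H α : ℝ≥0} (hα : 0 < α) (hH : HolderOnWith H α F (Icc a' b')) :
    ∃ C σ : ℝ, 0 < σ ∧ σ < 1 ∧ ∀ m : ℕ, ∀ x ∈ Icc a b, |f m x - F x| ≤ C * σ ^ m := by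
  let η := min (a - a') (b' - b)
  have hη : 0 < η := lt_min (by linarith) (by linarith)
  have hη1 : η ≤ a - a' := min_le_left _ _
  have hη2 : η ≤ b' - b := min_le_right _ _
  let r := Real.sqrt ρ
  have hr : 0 < r := Real.sqrt_pos.2 hρ
  have hr1 : r < 1 := by rw [Real.sqrt_lt' one_pos]; simpa using hρ1
  have hrr : r * r = ρ := Real.mul_self_sqrt hρ.le
  have hαr : (0 : ℝ) < α := hα
  let σ := max r (r ^ (α : ℝ))
  have hσr : r ≤ σ := le_max_left _ _
  have hσα : r ^ (α : ℝ) ≤ σ := le_max_right _ _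
  refine ⟨H * η ^ (α : ℝ) + C / η, σ, hr.trans_le hσr,
    max_lt hr1 (Real.rpow_lt_one hr.le hr1 hαr), fun m x hx => ?_⟩
  have hδ : 0 < η * r ^ m := by positivity
  have hδη : η * r ^ m ≤ η := mul_le_of_le_one_right hη.le (pow_le_one₀ hr.le hr1.le)
  have hDδ : C * ρ ^ m / (η * r ^ m) = C / η * r ^ m := by
    rw [← hrr, mul_pow]
    field_simp
  have hHol : ∀ y ∈ Icc a' b', |y - x| ≤ η * r ^ m →
      |F y - F x| ≤ H * η ^ (α : ℝ) * (r ^ (α : ℝ)) ^ m := by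
    intro y hy hyx
    have h1 := hH.dist_le hy (⟨by linarith [hx.1], by linarith [hx.2]⟩ : x ∈ Icc a' b')
    rw [Real.dist_eq, Real.dist_eq] at h1
    refine h1.trans ?_
    rw [mul_assoc]
    refine mul_le_mul_of_nonneg_left ?_ H.2
    refine (Real.rpow_le_rpow (abs_nonneg _) hyx hαr.le).trans_eq ?_
    rw [Real.mul_rpow hη.le (by positivity), ← Real.rpow_natCast, ← Real.rpow_natCast,
      ← Real.rpow_mul hr.le, ← Real.rpow_mul hr.le, mul_comm (m : ℝ)]
  have hb1 : H * η ^ (α : ℝ) * (r ^ (α : ℝ)) ^ m ≤ H * η ^ (α : ℝ) * σ ^ m := by gcongr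
  have hb2 : C / η * r ^ m ≤ C / η * σ ^ m := by gcongr
  have hup := (hm m).le_of_eLpNorm_sub_le hF (by positivity : 0 ≤ C * ρ ^ m) (h m)
    (c := F x + H * η ^ (α : ℝ) * (r ^ (α : ℝ)) ^ m)
    (by linarith [hx.1] : 0 ≤ x) hδ (by linarith [hx.2]) (fun y hy => by
      have := hHol y ⟨by linarith [hx.1, hy.1], by linarith [hx.2, hy.2]⟩
        (abs_le.2 ⟨by linarith [hy.1], by linarith [hy.2]⟩)
      linarith [(abs_le.1 this).2])
  have hlow := (hm m).ge_of_eLpNorm_sub_le hF (by positivity : 0 ≤ C * ρ ^ m) (h m)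
    (c := F x - H * η ^ (α : ℝ) * (r ^ (α : ℝ)) ^ m)
    (by linarith [hx.1] : 0 ≤ x - η * r ^ m) hδ (by linarith [hx.2]) (fun y hy => by
      have := hHol y ⟨by linarith [hx.1, hy.1], by linarith [hx.2, hy.2]⟩
        (abs_le.2 ⟨by linarith [hy.1], by linarith [hy.2]⟩)
      linarith [(abs_le.1 this).1])
  rw [hDδ] at hup hlow
  rw [abs_le, add_mul]
  constructor <;> linarith

/-! ### Eigenvalue counts of symmetric matrices -/

namespace Matrix

variable {n m : Type*} [Fintype n] [DecidableEq n] [Fintype m] [DecidableEq m]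

/-- The number of eigenvalues (roots of the characteristic polynomial, with multiplicity) which
are at most `t`. -/
noncomputable def eigenvalueCount (A : Matrix n n ℝ) (t : ℝ) : ℕ :=
  A.charpoly.roots.countP (· ≤ t)

/-- Links the characteristic polynomial, suited to reindexing and block matrices, with the
diagonalization, suited to quadratic forms. -/
theorem eigenvalueCount_eq_card {A : Matrix n n ℝ} (hA : A.IsHermitian) (t : ℝ) :
    A.eigenvalueCount t = (Finset.univ.filter fun i => hA.eigenvalues i ≤ t).card := by
  rw [eigenvalueCount, hA.roots_charpoly_eq_eigenvalues, Multiset.countP_map]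
  rfl

theorem eigenvalueCount_eq_card₀ {A : Matrix n n ℝ} (hA : A.IsHermitian) (t : ℝ) :
    A.eigenvalueCount t = (Finset.univ.filter fun i => hA.eigenvalues₀ i ≤ t).card := by
  rw [eigenvalueCount, hA.roots_charpoly_eq_eigenvalues₀, Multiset.countP_map]
  rfl

theorem IsHermitian.dotProduct_mulVec_eq_sum {A : Matrix n n ℝ} (hA : A.IsHermitian) (x : n → ℝ) :
    x ⬝ᵥ A *ᵥ x = ∑ i, hA.eigenvalues i * (⇑(hA.eigenvectorBasis i) ⬝ᵥ x) ^ 2 := by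
  have h := hA.eigenvectorBasis.sum_inner_mul_inner (WithLp.toLp 2 x) (WithLp.toLp 2 (A *ᵥ x))
  simp only [EuclideanSpace.inner_eq_star_dotProduct, star_trivial] at h
  rw [dotProduct_comm, ← h]
  refine Finset.sum_congr rfl fun i _ => ?_
  have h1 : (A *ᵥ x) ⬝ᵥ ⇑(hA.eigenvectorBasis i)
      = hA.eigenvalues i * (⇑(hA.eigenvectorBasis i) ⬝ᵥ x) := by
    have hT : Aᵀ = A := by simpa [IsHermitian, conjTranspose_eq_transpose_of_trivial] using hA
    rw [dotProduct_comm, dotProduct_mulVec, ← mulVec_transpose, hT, hA.mulVec_eigenvectorBasis,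
      smul_dotProduct, smul_eq_mul]
  rw [h1]
  ring

theorem IsHermitian.dotProduct_self_eq_sum {A : Matrix n n ℝ} (hA : A.IsHermitian) (x : n → ℝ) :
    x ⬝ᵥ x = ∑ i, (⇑(hA.eigenvectorBasis i) ⬝ᵥ x) ^ 2 := by
  have h := hA.eigenvectorBasis.sum_inner_mul_inner (WithLp.toLp 2 x) (WithLp.toLp 2 x)
  simp only [EuclideanSpace.inner_eq_star_dotProduct, star_trivial] at h
  rw [← h]
  refine Finset.sum_congr rfl fun i _ => ?_
  rw [dotProduct_comm x, sq]

/-- Weyl monotonicity: a larger quadratic form has fewer eigenvalues below every bound. -/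
theorem eigenvalueCount_le_of_forall_dotProduct_le {A B : Matrix n n ℝ} (hA : A.IsHermitian)
    (hB : B.IsHermitian) (h : ∀ x, x ⬝ᵥ A *ᵥ x ≤ x ⬝ᵥ B *ᵥ x) (t : ℝ) :
    B.eigenvalueCount t ≤ A.eigenvalueCount t := by
  -- A vector killed by `φ` is spanned by `B`-eigenvectors with eigenvalue at most `t` and also by
  -- `A`-eigenvectors with eigenvalue above `t`. Then `t|x|² ≤ x·Ax ≤ x·Bx ≤ t|x|²`, and equality
  -- forces `x = 0`. Injectivity gives `n ≤ (n - N_B) + N_A`, where `N_A`, `N_B` are the counts at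
  -- `t`.
  let φ : (n → ℝ) →ₗ[ℝ]
      ({i // ¬ hB.eigenvalues i ≤ t} → ℝ) × ({i // hA.eigenvalues i ≤ t} → ℝ) :=
    LinearMap.prod (LinearMap.pi fun i => dotProductBilin ℝ ℝ ⇑(hB.eigenvectorBasis i))
      (LinearMap.pi fun i => dotProductBilin ℝ ℝ ⇑(hA.eigenvectorBasis i))
  have hφ : Function.Injective φ := by
    rw [injective_iff_map_eq_zero]
    intro x hx
    have h1 : ∀ i, ¬ hB.eigenvalues i ≤ t → ⇑(hB.eigenvectorBasis i) ⬝ᵥ x = 0 := fun i hi =>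
      congrFun (congrArg Prod.fst hx) ⟨i, hi⟩
    have h2 : ∀ i, hA.eigenvalues i ≤ t → ⇑(hA.eigenvectorBasis i) ⬝ᵥ x = 0 := fun i hi =>
      congrFun (congrArg Prod.snd hx) ⟨i, hi⟩
    have hB1 : x ⬝ᵥ B *ᵥ x ≤ t * (x ⬝ᵥ x) := by
      rw [hB.dotProduct_mulVec_eq_sum, hB.dotProduct_self_eq_sum, Finset.mul_sum]
      refine Finset.sum_le_sum fun i _ => ?_
      by_cases hi : hB.eigenvalues i ≤ t
      · exact mul_le_mul_of_nonneg_right hi (sq_nonneg _)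
      · simp [h1 i hi]
    have hle : ∀ i, t * (⇑(hA.eigenvectorBasis i) ⬝ᵥ x) ^ 2
        ≤ hA.eigenvalues i * (⇑(hA.eigenvectorBasis i) ⬝ᵥ x) ^ 2 := by
      intro i
      by_cases hi : hA.eigenvalues i ≤ t
      · simp [h2 i hi]
      · exact mul_le_mul_of_nonneg_right (not_le.1 hi).le (sq_nonneg _)
    have hA1 : ∑ i, t * (⇑(hA.eigenvectorBasis i) ⬝ᵥ x) ^ 2
        = ∑ i, hA.eigenvalues i * (⇑(hA.eigenvectorBasis i) ⬝ᵥ x) ^ 2 := by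
      refine le_antisymm (Finset.sum_le_sum fun i _ => hle i) ?_
      rw [← Finset.mul_sum, ← hA.dotProduct_self_eq_sum, ← hA.dotProduct_mulVec_eq_sum]
      exact (h x).trans hB1
    have hz := (Finset.sum_eq_sum_iff_of_le fun i _ => hle i).1 hA1
    have h3 : ∀ i, ⇑(hA.eigenvectorBasis i) ⬝ᵥ x = 0 := by
      intro i
      by_cases hi : hA.eigenvalues i ≤ t
      · exact h2 i hi
      · have h4 := hz i (Finset.mem_univ _)
        have h5 : (hA.eigenvalues i - t) * (⇑(hA.eigenvectorBasis i) ⬝ᵥ x) ^ 2 = 0 := by linarith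
        rcases mul_eq_zero.1 h5 with h6 | h6
        · exact absurd h6 (by linarith [not_le.1 hi])
        · exact pow_eq_zero_iff two_ne_zero |>.1 h6
    have h7 : x ⬝ᵥ x = 0 := by rw [hA.dotProduct_self_eq_sum]; simp [h3]
    exact dotProduct_self_eq_zero.1 h7
  have hfr := LinearMap.finrank_le_finrank_of_injective hφ
  rw [Module.finrank_prod, Module.finrank_fintype_fun_eq_card, Module.finrank_fintype_fun_eq_card,
    Module.finrank_fintype_fun_eq_card, Fintype.card_subtype_compl,
    Fintype.card_subtype, Fintype.card_subtype, ← eigenvalueCount_eq_card,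
    ← eigenvalueCount_eq_card] at hfr
  have : B.eigenvalueCount t ≤ Fintype.card n := by
    rw [eigenvalueCount_eq_card hB]
    exact Finset.card_le_univ _
  omega

theorem charpoly_blockDiagonal {o : Type*} [Fintype o] [DecidableEq o] (M : o → Matrix n n ℝ) :
    (blockDiagonal M).charpoly = ∏ k, (M k).charpoly := by
  unfold charpoly
  rw [← det_blockDiagonal]
  congr 1
  ext ⟨i, k⟩ ⟨j, l⟩ : 1
  rw [charmatrix_apply, blockDiagonal_apply, blockDiagonal_apply, diagonal_apply]
  by_cases hkl : k = l
  · subst hkl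
    simp [charmatrix_apply, diagonal_apply]
  · simp [hkl]

/-- The characteristic polynomial factors over the blocks; the roots `0` of the zero block are
counted because `0 ≤ t`. -/
theorem eigenvalueCount_fromBlocks_blockDiagonal {o : Type*} [Fintype o] [DecidableEq o]
    (A : Matrix n n ℝ) {t : ℝ} (ht : 0 ≤ t) :
    (fromBlocks (blockDiagonal fun _ : o => A) 0 0 (0 : Matrix m m ℝ)).eigenvalueCount t
      = Fintype.card o * A.eigenvalueCount t + Fintype.card m := by
  have h1 : ((A.charpoly) ^ Fintype.card o).Monic := (charpoly_monic A).pow _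
  have h2 : ((Polynomial.X : Polynomial ℝ) ^ Fintype.card m).Monic := Polynomial.monic_X_pow _
  rw [eigenvalueCount, charpoly_fromBlocks_zero₁₂, charpoly_blockDiagonal, charpoly_zero,
    Finset.prod_const, Finset.card_univ, Polynomial.roots_mul (h1.mul h2).ne_zero,
    Polynomial.roots_pow, Polynomial.roots_pow, Polynomial.roots_X, Multiset.countP_add,
    Multiset.countP_nsmul, Multiset.countP_nsmul, eigenvalueCount]
  simp [← Multiset.cons_zero, ht]

end Matrix

/-! ### Spectral functions through eigenvalue counts -/

/-- The sublevel sets of a monotone `g` are initial segments of `Fin n`. This turns comparisons of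
sorted eigenvalues into comparisons of counts. -/
theorem card_filter_le_of_monotone {n : ℕ} {g : Fin n → ℝ} (hg : Monotone g) (k : Fin n) (t : ℝ) :
    g k ≤ t ↔ (k : ℕ) < (Finset.univ.filter fun i => g i ≤ t).card := by
  constructor
  · intro h
    have : Finset.Iic k ⊆ Finset.univ.filter fun i => g i ≤ t := fun i hi => by
      simpa using (hg (Finset.mem_Iic.1 hi)).trans h
    have := Finset.card_le_card this
    rw [Fin.card_Iic] at this
    omega
  · intro h
    by_contra hk
    have : (Finset.univ.filter fun i => g i ≤ t) ⊆ Finset.Iio k := fun i hi => by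
      rw [Finset.mem_Iio]
      by_contra hik
      exact hk ((hg (not_lt.1 hik)).trans (Finset.mem_filter.1 hi).2)
    have := Finset.card_le_card this
    rw [Fin.card_Iio] at this
    omega

theorem integral_floor_step {n : ℕ} (hn : 0 < n) (g : ℕ → ℝ) :
    ∫ x in (0 : ℝ)..1, g (min ⌊(n : ℝ) * x⌋₊ (n - 1)) = (∑ k ∈ Finset.range n, g k) / n := by
  have hn' : (n : ℝ) ≠ 0 := by positivity
  rw [intervalIntegral.integral_comp_mul_left (fun y => g (min ⌊y⌋₊ (n - 1))) hn', mul_zero, mul_one]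
  have hcongr : ∀ k < n, EqOn (fun _ => g k) (fun y : ℝ => g (min ⌊y⌋₊ (n - 1)))
      (Ioo (k : ℝ) ((k + 1 : ℕ) : ℝ)) := by
    intro k hk y hy
    have : ⌊y⌋₊ = k := by
      rw [Nat.floor_eq_iff ((Nat.cast_nonneg k).trans hy.1.le)]
      exact ⟨hy.1.le, by simpa using hy.2⟩
    simp only [this]
    rw [min_eq_left (by omega)]
  have hle : ∀ k : ℕ, (k : ℝ) ≤ ((k + 1 : ℕ) : ℝ) := fun k => by simp
  have h := intervalIntegral.sum_integral_adjacent_intervals (μ := volume)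
    (f := fun y : ℝ => g (min ⌊y⌋₊ (n - 1))) (a := fun k : ℕ => (k : ℝ)) (n := n) (fun k hk =>
      (intervalIntegrable_const (c := g k)).congr_uIoo (by
        rw [uIoo_of_le (hle k)]
        exact hcongr k hk))
  rw [Nat.cast_zero] at h
  rw [← h, smul_eq_mul, div_eq_inv_mul]
  congr 1
  refine Finset.sum_congr rfl fun k hk => ?_
  rw [← intervalIntegral.integral_congr_Ioo_of_le (hle k) (hcongr k (Finset.mem_range.1 hk))]
  simp

namespace FiniteGraph

open Classical in
/-- The Laplace matrix. -/
noncomputable def laplacian (H : FiniteGraph.{u}) : Matrix H.V H.V ℝ := H.graph.lapMatrix ℝ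

open Classical in
theorem isHermitian_laplacian (H : FiniteGraph.{u}) : H.laplacian.IsHermitian :=
  SimpleGraph.isHermitian_lapMatrix ℝ H.graph

open Classical in
/-- The number of Laplace eigenvalues which are at most `t`. -/
noncomputable def spectralCount (H : FiniteGraph.{u}) (t : ℝ) : ℕ := H.laplacian.eigenvalueCount t

open Classical in
theorem laplaceEigenvalue_of_lt (H : FiniteGraph.{u}) {k : ℕ} (hk : k < Fintype.card H.V) :
    H.laplaceEigenvalue k = H.isHermitian_laplacian.eigenvalues₀ (Fin.rev ⟨k, hk⟩) := by
  rw [laplaceEigenvalue, dif_pos hk]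
  rfl

theorem laplaceEigenvalue_le_iff (H : FiniteGraph.{u}) {k : ℕ} (hk : k < Fintype.card H.V) (t : ℝ) :
    H.laplaceEigenvalue k ≤ t ↔ k < H.spectralCount t := by
  classical
  have hmono : Monotone fun i : Fin (Fintype.card H.V) =>
      H.isHermitian_laplacian.eigenvalues₀ (Fin.rev i) :=
    fun i j hij => H.isHermitian_laplacian.eigenvalues₀_antitone (Fin.rev_le_rev.2 hij)
  rw [laplaceEigenvalue_of_lt H hk, spectralCount,
    Matrix.eigenvalueCount_eq_card₀ H.isHermitian_laplacian]
  refine (card_filter_le_of_monotone hmono ⟨k, hk⟩ t).trans ?_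
  have : (Finset.univ.filter fun i : Fin (Fintype.card H.V) =>
      H.isHermitian_laplacian.eigenvalues₀ (Fin.rev i) ≤ t).card =
      (Finset.univ.filter fun i => H.isHermitian_laplacian.eigenvalues₀ i ≤ t).card :=
    Finset.card_bij (fun i _ => Fin.rev i) (by simp) (by simp)
      (fun b hb => ⟨Fin.rev b, by simpa using hb, by simp⟩)
  rw [this]

theorem laplaceEigenvalue_nonneg (H : FiniteGraph.{u}) (k : ℕ) : 0 ≤ H.laplaceEigenvalue k := by
  classical
  by_cases hk : k < Fintype.card H.V
  · rw [laplaceEigenvalue_of_lt H hk]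
    have hps : H.laplacian.PosSemidef := SimpleGraph.posSemidef_lapMatrix ℝ H.graph
    have := hps.eigenvalues_nonneg
      ((Fintype.equivOfCardEq (Fintype.card_fin _)) (Fin.rev ⟨k, hk⟩))
    simpa [Matrix.IsHermitian.eigenvalues] using this
  · rw [laplaceEigenvalue, dif_neg hk]

theorem laplaceEigenvalue_mono (H : FiniteGraph.{u}) {j k : ℕ} (hjk : j ≤ k) (hk : k < H.order) :
    H.laplaceEigenvalue j ≤ H.laplaceEigenvalue k := by
  rw [laplaceEigenvalue_le_iff H (hjk.trans_lt hk)]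
  exact hjk.trans_lt ((laplaceEigenvalue_le_iff H hk _).1 le_rfl)

theorem laplaceEigenvalue_zero (H : FiniteGraph.{u}) (hH : 0 < H.order) :
    H.laplaceEigenvalue 0 = 0 := by
  classical
  refine le_antisymm ?_ (H.laplaceEigenvalue_nonneg 0)
  rw [laplaceEigenvalue_le_iff H hH]
  have : Nonempty H.V := Fintype.card_pos_iff.1 hH
  have hdet : H.laplacian.det = 0 := SimpleGraph.det_lapMatrix_eq_zero H.graph
  rw [H.isHermitian_laplacian.det_eq_prod_eigenvalues, Finset.prod_eq_zero_iff] at hdet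
  obtain ⟨i, -, hi⟩ := hdet
  rw [spectralCount, Matrix.eigenvalueCount_eq_card H.isHermitian_laplacian, Finset.card_pos]
  exact ⟨i, by simpa using (show H.isHermitian_laplacian.eigenvalues i = 0 by simpa using hi).le⟩

/-- Both sides are the trace of the Laplacian. -/
theorem sum_laplaceEigenvalue (H : FiniteGraph.{u}) :
    ∑ k ∈ Finset.range H.order, H.laplaceEigenvalue k = 2 * H.graph.edgeSet.ncard := by
  classical
  have h1 : ∑ k ∈ Finset.range H.order, H.laplaceEigenvalue k
      = ∑ i, H.isHermitian_laplacian.eigenvalues i := by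
    rw [order, ← Fin.sum_univ_eq_sum_range, ← Equiv.sum_comp
      (Fintype.equivOfCardEq (Fintype.card_fin _)) H.isHermitian_laplacian.eigenvalues,
      ← Equiv.sum_comp Fin.revPerm]
    refine Finset.sum_congr rfl fun i _ => ?_
    rw [laplaceEigenvalue_of_lt H (Fin.is_lt _), Fin.eta, Fin.revPerm_apply, Fin.rev_rev,
      Matrix.IsHermitian.eigenvalues, Equiv.symm_apply_apply]
  have h2 : H.laplacian.trace = ∑ v, (H.graph.degree v : ℝ) := by
    simp [laplacian, SimpleGraph.lapMatrix, SimpleGraph.degMatrix, Matrix.trace]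
  have h3 := H.isHermitian_laplacian.trace_eq_sum_eigenvalues
  have h4 := H.graph.sum_degrees_eq_twice_card_edges
  rw [h1, Set.ncard_eq_toFinset_card']
  have h5 : (∑ v, (H.graph.degree v : ℝ)) = 2 * (H.graph.edgeFinset.card : ℝ) := by exact_mod_cast h4
  simp only [RCLike.ofReal_real_eq_id, id] at h3
  rw [← h3, h2, h5]
  rfl

theorem spectralFunction_index_lt (H : FiniteGraph.{u}) (hH : 0 < H.order) (x : ℝ) :
    min ⌊(H.order : ℝ) * x⌋₊ (H.order - 1) < H.order :=
  (min_le_right _ _).trans_lt (Nat.sub_lt hH one_pos)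

theorem spectralFunction_nonneg (H : FiniteGraph.{u}) (x : ℝ) : 0 ≤ H.spectralFunction x :=
  H.laplaceEigenvalue_nonneg _

theorem spectralFunction_zero (H : FiniteGraph.{u}) (hH : 0 < H.order) :
    H.spectralFunction 0 = 0 := by
  simp [spectralFunction, laplaceEigenvalue_zero H hH]

theorem monotone_spectralFunction (H : FiniteGraph.{u}) (hH : 0 < H.order) :
    Monotone H.spectralFunction := fun x y hxy =>
  H.laplaceEigenvalue_mono (min_le_min_right _ (Nat.floor_mono (by gcongr)))
    (H.spectralFunction_index_lt hH y)

/-- The point `x = 1` must be left out: there the index is clipped to `n - 1`, while the right side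
would ask for a count above `n`. -/
theorem spectralFunction_le_iff (H : FiniteGraph.{u}) (hH : 0 < H.order) {x : ℝ}
    (hx : x ∈ Ico (0 : ℝ) 1) (t : ℝ) :
    H.spectralFunction x ≤ t ↔ H.order * x < H.spectralCount t := by
  have hn : (0 : ℝ) < H.order := by exact_mod_cast hH
  have h1 : ⌊(H.order : ℝ) * x⌋₊ < H.order := by
    rw [Nat.floor_lt (mul_nonneg hn.le hx.1)]
    nlinarith [hx.2]
  rw [spectralFunction, laplaceEigenvalue_le_iff H (H.spectralFunction_index_lt hH x),
    min_eq_left (by omega), Nat.floor_lt (mul_nonneg hn.le hx.1)]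

theorem integral_spectralFunction (H : FiniteGraph.{u}) (hH : 0 < H.order) :
    ∫ x in (0 : ℝ)..1, H.spectralFunction x = 2 * H.graph.edgeSet.ncard / H.order := by
  rw [← sum_laplaceEigenvalue, ← integral_floor_step hH]
  rfl

end FiniteGraph

/-- The difference is nonnegative off the null set `{1}`, so its norm is its integral. For spectral
functions this makes the distance a difference of average degrees. -/
theorem eLpNorm_sub_of_le {f g : ℝ → ℝ} (hf : Monotone f) (hg : Monotone g)
    (h : ∀ x ∈ Ico (0 : ℝ) 1, g x ≤ f x) :
    eLpNorm (f - g) 1 μ₁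
      = ENNReal.ofReal ((∫ x in (0 : ℝ)..1, f x) - ∫ x in (0 : ℝ)..1, g x) := by
  have hfi := hf.intervalIntegrable (μ := volume) (a := 0) (b := 1)
  have hgi := hg.intervalIntegrable (μ := volume) (a := 0) (b := 1)
  rw [← intervalIntegral.integral_sub hfi hgi, intervalIntegral.integral_of_le zero_le_one,
    ← integral_Icc_eq_integral_Ioc, eLpNorm_one_eq_lintegral_enorm]
  have hi : Integrable (fun x => f x - g x) μ₁ :=
    (memLp_one_iff_integrable.1 (hf.monotoneOn _).memLp_unit).sub
      (memLp_one_iff_integrable.1 (hg.monotoneOn _).memLp_unit)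
  have hae : ∀ᵐ x ∂μ₁, 0 ≤ f x - g x := by
    have : ∀ᵐ x ∂(volume.restrict (Ico (0 : ℝ) 1)), 0 ≤ f x - g x :=
      (ae_restrict_iff' measurableSet_Ico).2 (Eventually.of_forall fun x hx => sub_nonneg.2 (h x hx))
    rwa [restrict_Ico_eq_restrict_Icc] at this
  rw [ofReal_integral_eq_lintegral_ofReal hi hae]
  refine lintegral_congr_ae ?_
  filter_upwards [hae] with x hx
  rw [Pi.sub_apply, Real.enorm_of_nonneg hx]

/-! ### Deleting edges, disjoint copies and isolated vertices -/

namespace FiniteGraph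

open Classical in
theorem dotProduct_laplacian (H : FiniteGraph.{u}) (x : H.V → ℝ) :
    x ⬝ᵥ Matrix.mulVec H.laplacian x
      = (∑ i, ∑ j, if H.graph.Adj i j then (x i - x j) ^ 2 else 0) / 2 := by
  rw [laplacian, ← SimpleGraph.lapMatrix_toLinearMap₂', Matrix.toLinearMap₂'_apply']

/-- The quadratic form of the Laplacian is a sum of squares over the edges, so it shrinks when edges
are deleted; then Weyl monotonicity applies. -/
theorem spectralCount_le_of_le {V : Type u} [inst : Fintype V] {G G' : SimpleGraph V}
    (hle : G' ≤ G) (t : ℝ) :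
    spectralCount ⟨V, inst, G⟩ t ≤ spectralCount ⟨V, inst, G'⟩ t := by
  classical
  have h : ∀ x : V → ℝ, x ⬝ᵥ Matrix.mulVec (laplacian ⟨V, inst, G'⟩) x
      ≤ x ⬝ᵥ Matrix.mulVec (laplacian ⟨V, inst, G⟩) x := by
    intro x
    refine (dotProduct_laplacian ⟨V, inst, G'⟩ x).trans_le
      (le_trans ?_ (dotProduct_laplacian ⟨V, inst, G⟩ x).ge)
    refine div_le_div_of_nonneg_right
      (Finset.sum_le_sum fun i _ => Finset.sum_le_sum fun j _ => ?_) zero_le_two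
    by_cases h : G'.Adj i j
    · rw [if_pos h, if_pos (hle h)]
    · rw [if_neg h]
      split_ifs
      · positivity
      · exact le_rfl
  exact Matrix.eigenvalueCount_le_of_forall_dotProduct_le (n := V)
    (isHermitian_laplacian ⟨V, inst, G'⟩) (isHermitian_laplacian ⟨V, inst, G⟩) h t

open Classical in
theorem laplacian_apply (H : FiniteGraph.{u}) (x y : H.V) :
    H.laplacian x y = (if x = y then ∑ z, if H.graph.Adj x z then (1 : ℝ) else 0 else 0)
      - if H.graph.Adj x y then 1 else 0 := by
  rw [laplacian, SimpleGraph.lapMatrix, Matrix.sub_apply, SimpleGraph.degMatrix,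
    Matrix.diagonal_apply, SimpleGraph.adjMatrix_apply, SimpleGraph.degree_eq_sum_if_adj]

section Copies

universe v w₁ w₂

variable {H : FiniteGraph.{u}} {I : FiniteGraph.{v}} {S : Type w₁} {Z : Type w₂} [Fintype S]
  [Fintype Z]

/-- The Laplace spectrum of disjoint copies of a graph, together with isolated vertices. -/
theorem spectralCount_of_copies (e : (I.V × S) ⊕ Z ≃ H.V)
    (h₁ : ∀ x y s t, H.graph.Adj (e (.inl (x, s))) (e (.inl (y, t))) ↔ s = t ∧ I.graph.Adj x y)
    (h₂ : ∀ z v, ¬ H.graph.Adj (e (.inr z)) v) {t : ℝ} (ht : 0 ≤ t) :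
    H.spectralCount t = Fintype.card S * I.spectralCount t + Fintype.card Z := by
  classical
  have h₃ : ∀ z v, ¬ H.graph.Adj v (e (.inr z)) := fun z v h => h₂ z v h.symm
  rw [spectralCount, spectralCount, ← Matrix.eigenvalueCount_fromBlocks_blockDiagonal _ ht,
    Matrix.eigenvalueCount, Matrix.eigenvalueCount, ← Matrix.charpoly_reindex e]
  congr 3
  ext v w
  obtain ⟨v, rfl⟩ := e.surjective v
  obtain ⟨w, rfl⟩ := e.surjective w
  rw [Matrix.reindex_apply, Matrix.submatrix_apply, e.symm_apply_apply, e.symm_apply_apply,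
    laplacian_apply]
  rcases v with ⟨x, s⟩ | z
  · rcases w with ⟨y, t⟩ | z'
    · rw [Matrix.fromBlocks_apply₁₁, Matrix.blockDiagonal_apply]
      simp only [laplacian_apply, h₁, ← Equiv.sum_comp e, Fintype.sum_sum_type, h₃,
        Fintype.sum_prod_type, e.apply_eq_iff_eq, Sum.inl.injEq, Prod.mk.injEq]
      by_cases hst : s = t
      · subst hst
        simp [ite_and]
      · simp [hst]
    · simp [h₃]
  · rcases w with y | z' <;> simp [h₂]

theorem order_eq_of_copies (e : (I.V × S) ⊕ Z ≃ H.V) :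
    H.order = Fintype.card S * I.order + Fintype.card Z := by
  rw [order, ← Fintype.card_congr e, Fintype.card_sum, Fintype.card_prod, mul_comm]
  rfl

theorem edges_eq_of_copies (e : (I.V × S) ⊕ Z ≃ H.V)
    (h₁ : ∀ x y s t, H.graph.Adj (e (.inl (x, s))) (e (.inl (y, t))) ↔ s = t ∧ I.graph.Adj x y)
    (h₂ : ∀ z v, ¬ H.graph.Adj (e (.inr z)) v) :
    H.graph.edgeSet.ncard = Fintype.card S * I.graph.edgeSet.ncard := by
  classical
  have h₃ : ∀ z v, ¬ H.graph.Adj v (e (.inr z)) := fun z v h => h₂ z v h.symm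
  have key : ∀ K : FiniteGraph, 2 * K.graph.edgeSet.ncard
      = ∑ x, ∑ y, if K.graph.Adj x y then 1 else 0 := by
    intro K
    rw [Set.ncard_eq_toFinset_card']
    refine (K.graph.sum_degrees_eq_twice_card_edges).symm.trans ?_
    refine Finset.sum_congr rfl fun x _ => ?_
    simpa using SimpleGraph.degree_eq_sum_if_adj (R := ℕ) K.graph x
  have hI := key I
  have hH : 2 * H.graph.edgeSet.ncard = ∑ x, ∑ y, if H.graph.Adj x y then 1 else 0 := by
    rw [Set.ncard_eq_toFinset_card']
    refine (H.graph.sum_degrees_eq_twice_card_edges).symm.trans ?_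
    refine Finset.sum_congr rfl fun x _ => ?_
    simpa using SimpleGraph.degree_eq_sum_if_adj (R := ℕ) H.graph x
  have : ∑ x, ∑ y, (if H.graph.Adj x y then 1 else 0)
      = Fintype.card S * ∑ x, ∑ y, if I.graph.Adj x y then 1 else 0 := by
    simp only [← Equiv.sum_comp e, Fintype.sum_sum_type, Fintype.sum_prod_type, h₁, h₂, h₃, ite_and]
    simp [← Finset.mul_sum]
  rw [← hI, ← hH] at this
  linarith

/-- Copies leave the normalized spectrum unchanged, and the zeros of the isolated vertices enter at
its bottom and push the rest to the right. -/
theorem spectralFunction_le_of_copies [Nonempty S] (hI : 0 < I.order) (e : (I.V × S) ⊕ Z ≃ H.V)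
    (h₁ : ∀ x y s t, H.graph.Adj (e (.inl (x, s))) (e (.inl (y, t))) ↔ s = t ∧ I.graph.Adj x y)
    (h₂ : ∀ z v, ¬ H.graph.Adj (e (.inr z)) v) {x : ℝ} (hx : x ∈ Ico (0 : ℝ) 1) :
    H.spectralFunction x ≤ I.spectralFunction x := by
  have hS : 0 < Fintype.card S := Fintype.card_pos
  have hord := order_eq_of_copies e
  have hH : 0 < H.order := by rw [hord]; positivity
  rw [spectralFunction_le_iff H hH hx, spectralCount_of_copies e h₁ h₂ (I.spectralFunction_nonneg x),
    hord]
  have h := (spectralFunction_le_iff I hI hx _).1 le_rfl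
  have hS' : (0 : ℝ) < Fintype.card S := by exact_mod_cast hS
  push_cast
  have h3 : (Fintype.card Z : ℝ) * x ≤ Fintype.card Z :=
    mul_le_of_le_one_right (by positivity) hx.2.le
  have h4 := mul_lt_mul_of_pos_left h hS'
  linarith

/-- If a graph becomes, after some edges are removed, a union of disjoint copies of a graph `I` and
of isolated vertices, then the spectral functions are close in `L¹`. -/
theorem eLpNorm_spectralFunction_sub_le [Nonempty S] (hI : 0 < I.order)
    {G' : SimpleGraph H.V} (hle : G' ≤ H.graph) (e : (I.V × S) ⊕ Z ≃ H.V)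
    (h₁ : ∀ x y s t, G'.Adj (e (.inl (x, s))) (e (.inl (y, t))) ↔ s = t ∧ I.graph.Adj x y)
    (h₂ : ∀ z v, ¬ G'.Adj (e (.inr z)) v) :
    eLpNorm (H.spectralFunction - I.spectralFunction) 1 μ₁ ≤ ENNReal.ofReal
      (2 * (H.graph.edgeSet \ G'.edgeSet).ncard / H.order
        + 2 * H.graph.edgeSet.ncard * Fintype.card Z
          / (H.order * (Fintype.card S * I.order))) := by
  let H' : FiniteGraph := ⟨H.V, H.fintypeV, G'⟩
  have hS : 0 < Fintype.card S := Fintype.card_pos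
  have hord := order_eq_of_copies e
  have hH : 0 < H.order := by rw [hord]; positivity
  have hH' : 0 < H'.order := hH
  have hm := H.monotone_spectralFunction hH
  have hm' := H'.monotone_spectralFunction hH'
  have hmI := I.monotone_spectralFunction hI
  -- First change, deleting edges: the spectral function decreases, and its integral drops by twice
  -- the number of deleted edges over `n`.
  have hA : eLpNorm (H.spectralFunction - H'.spectralFunction) 1 μ₁
      = ENNReal.ofReal (2 * (H.graph.edgeSet \ G'.edgeSet).ncard / H.order) := by
    rw [eLpNorm_sub_of_le hm hm' fun x hx => ?_, integral_spectralFunction H hH,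
      integral_spectralFunction H' hH']
    · congr 1
      have : G'.edgeSet.ncard + (H.graph.edgeSet \ G'.edgeSet).ncard = H.graph.edgeSet.ncard := by
        rw [add_comm]
        exact Set.ncard_sdiff_add_ncard_of_subset (SimpleGraph.edgeSet_mono hle) (Set.toFinite _)
      rw [← this]
      push_cast
      change _ - 2 * (G'.edgeSet.ncard : ℝ) / (H.order : ℝ) = _
      ring
    · rw [spectralFunction_le_iff H' hH' hx]
      refine ((spectralFunction_le_iff H hH hx _).1 le_rfl).trans_le ?_
      exact_mod_cast spectralCount_le_of_le hle _
  -- Second change, discarding the isolated vertices: the spectral function increases, and the gain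
  -- in average degree is proportional to `card Z`.
  have hB : eLpNorm (H'.spectralFunction - I.spectralFunction) 1 μ₁
      ≤ ENNReal.ofReal (2 * H.graph.edgeSet.ncard * Fintype.card Z
          / (H.order * (Fintype.card S * I.order))) := by
    rw [eLpNorm_sub_comm, eLpNorm_sub_of_le hmI hm' fun x hx =>
      spectralFunction_le_of_copies (H := H') hI e h₁ h₂ hx, integral_spectralFunction I hI,
      integral_spectralFunction H' hH']
    refine ENNReal.ofReal_le_ofReal ?_
    have hedge : G'.edgeSet.ncard = Fintype.card S * I.graph.edgeSet.ncard :=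
      edges_eq_of_copies (H := H') e h₁ h₂
    have hmono : Fintype.card S * I.graph.edgeSet.ncard ≤ H.graph.edgeSet.ncard := by
      rw [← hedge]
      exact Set.ncard_le_ncard (SimpleGraph.edgeSet_mono hle) (Set.toFinite _)
    have hmono' : (Fintype.card S * I.graph.edgeSet.ncard : ℝ) ≤ H.graph.edgeSet.ncard := by
      exact_mod_cast hmono
    change _ - 2 * (G'.edgeSet.ncard : ℝ) / (H.order : ℝ) ≤ _
    have hS' : (0 : ℝ) < Fintype.card S := by exact_mod_cast hS
    have hI' : (0 : ℝ) < I.order := by exact_mod_cast hI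
    have hH0 : (0 : ℝ) < H.order := by exact_mod_cast hH
    have hordR : (H.order : ℝ) = Fintype.card S * I.order + Fintype.card Z := by
      exact_mod_cast hord
    have hcalc : 2 * (I.graph.edgeSet.ncard : ℝ) / I.order - 2 * (G'.edgeSet.ncard : ℝ) / H.order
        = 2 * (Fintype.card S * I.graph.edgeSet.ncard : ℝ) * Fintype.card Z
          / (H.order * (Fintype.card S * I.order)) := by
      rw [hedge]
      push_cast
      rw [div_sub_div _ _ hI'.ne' hH0.ne', div_eq_div_iff (by positivity) (by positivity), hordR]
      ring
    rw [hcalc]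
    gcongr
  calc eLpNorm (H.spectralFunction - I.spectralFunction) 1 μ₁
      = eLpNorm ((H.spectralFunction - H'.spectralFunction)
          + (H'.spectralFunction - I.spectralFunction)) 1 μ₁ := by rw [sub_add_sub_cancel]
    _ ≤ eLpNorm (H.spectralFunction - H'.spectralFunction) 1 μ₁
          + eLpNorm (H'.spectralFunction - I.spectralFunction) 1 μ₁ :=
        eLpNorm_add_le ((hm.monotoneOn _).memLp_unit.sub (hm'.monotoneOn _).memLp_unit).1
          ((hm'.monotoneOn _).memLp_unit.sub (hmI.monotoneOn _).memLp_unit).1 le_rfl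
    _ ≤ _ := by
        rw [ENNReal.ofReal_add (by positivity) (by positivity)]
        exact add_le_add hA.le hB

end Copies

end FiniteGraph

/-! ### Maximal flags of a finite set -/

namespace Finset

theorem injOn_card_of_chain {α : Type*} {C : Finset (Finset α)}
    (h : ∀ r ∈ C, ∀ s ∈ C, r ⊆ s ∨ s ⊆ r) :
    Set.InjOn Finset.card (C : Set (Finset α)) := by
  intro r hr s hs hrs
  rcases h r hr s hs with h1 | h1
  · exact eq_of_subset_of_card_le h1 hrs.ge
  · exact (eq_of_subset_of_card_le h1 hrs.le).symm

theorem image_card_subset_of_chain {α : Type*} {t : Finset α} {C : Finset (Finset α)}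
    (ht : ∀ s ∈ C, s ⊆ t)
    (h0 : ∅ ∉ C) : C.image Finset.card ⊆ Icc 1 t.card := by
  intro k hk
  obtain ⟨s, hs, rfl⟩ := mem_image.1 hk
  rw [mem_Icc]
  refine ⟨card_pos.2 (nonempty_iff_ne_empty.2 fun h => h0 (h ▸ hs)), card_le_card (ht s hs)⟩


theorem card_le_of_chain {α : Type*} {t : Finset α} {C : Finset (Finset α)}
    (ht : ∀ s ∈ C, s ⊆ t)
    (h0 : ∅ ∉ C) (h : ∀ r ∈ C, ∀ s ∈ C, r ⊆ s ∨ s ⊆ r) : C.card ≤ t.card := by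
  rw [← card_image_of_injOn (injOn_card_of_chain h)]
  simpa using card_le_card (image_card_subset_of_chain ht h0)

variable {α : Type*} [DecidableEq α]

/-- The maximal flags of nonempty subsets of a finite set. -/
def fullFlags (t : Finset α) : Finset (Finset (Finset α)) :=
  t.powerset.powerset.filter fun C => (∅ ∉ C ∧ C.card = t.card) ∧
    ∀ r ∈ C, ∀ s ∈ C, r ⊆ s ∨ s ⊆ r

theorem mem_fullFlags {t : Finset α} {C : Finset (Finset α)} :
    C ∈ fullFlags t ↔ (∀ s ∈ C, s ⊆ t) ∧ ∅ ∉ C ∧ C.card = t.card ∧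
      ∀ r ∈ C, ∀ s ∈ C, r ⊆ s ∨ s ⊆ r := by
  simp only [fullFlags, mem_filter, mem_powerset, subset_iff (s₁ := C), and_assoc]

/-- Members of a chain have distinct cardinalities, all in `[1, t.card]`; a chain with `t.card`
members must attain each of them. -/
theorem exists_mem_card_eq_of_mem_fullFlags {t : Finset α} {C : Finset (Finset α)}
    (hC : C ∈ fullFlags t) {k : ℕ} (hk : 1 ≤ k) (hkt : k ≤ t.card) : ∃ s ∈ C, s.card = k := by
  obtain ⟨ht, h0, hcard, hch⟩ := mem_fullFlags.1 hC
  have : C.image Finset.card = Icc 1 t.card := by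
    refine eq_of_subset_of_card_le (image_card_subset_of_chain ht h0) ?_
    rw [card_image_of_injOn (injOn_card_of_chain hch), hcard]
    simp
  have hk' : k ∈ C.image Finset.card := by rw [this]; exact mem_Icc.2 ⟨hk, hkt⟩
  exact mem_image.1 hk'

theorem self_mem_of_mem_fullFlags {t : Finset α} (ht : t.Nonempty) {C : Finset (Finset α)}
    (hC : C ∈ fullFlags t) : t ∈ C := by
  obtain ⟨s, hs, hst⟩ := exists_mem_card_eq_of_mem_fullFlags hC (card_pos.2 ht) le_rfl
  rwa [← eq_of_subset_of_card_le ((mem_fullFlags.1 hC).1 s hs) hst.ge]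

theorem insert_mem_fullFlags {t : Finset α} {v : α} (hv : v ∈ t) {C : Finset (Finset α)}
    (hC : C ∈ fullFlags (t.erase v)) : t ∉ C ∧ insert t C ∈ fullFlags t := by
  obtain ⟨h1, h0, hcard, hch⟩ := mem_fullFlags.1 hC
  have hsub : ∀ s ∈ C, s ⊆ t := fun s hs => (h1 s hs).trans (erase_subset v t)
  have htC : t ∉ C := fun h => notMem_erase v t (h1 t h hv)
  refine ⟨htC, mem_fullFlags.2 ⟨?_, ?_, ?_, ?_⟩⟩
  · intro s hs
    rcases mem_insert.1 hs with rfl | hs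
    · exact Subset.rfl
    · exact hsub s hs
  · rw [mem_insert, not_or]
    exact ⟨fun h => by simp [← h] at hv, h0⟩
  · rw [card_insert_of_notMem htC, hcard, card_erase_add_one hv]
  · intro r hr s hs
    rcases mem_insert.1 hs with hst | hs'
    · rw [hst]
      rcases mem_insert.1 hr with hrt | hr'
      · exact Or.inl hrt.le
      · exact Or.inl (hsub r hr')
    · rcases mem_insert.1 hr with hrt | hr'
      · rw [hrt]
        exact Or.inr (hsub s hs')
      · exact hch r hr' s hs'

/-- The member of cardinality `t.card - 1` is `t.erase v` for some `v`, and it contains every other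
proper member. -/
theorem exists_erase_mem_fullFlags {t : Finset α} (ht : 2 ≤ t.card) {C : Finset (Finset α)}
    (hC : C ∈ fullFlags t) : ∃ v ∈ t, C.erase t ∈ fullFlags (t.erase v) := by
  obtain ⟨h1, h0, hcard, hch⟩ := mem_fullFlags.1 hC
  have htC : t ∈ C := self_mem_of_mem_fullFlags (card_pos.1 (by omega)) hC
  obtain ⟨s, hs, hsc⟩ := exists_mem_card_eq_of_mem_fullFlags hC (k := t.card - 1) (by omega)
    (by omega)
  obtain ⟨v, hvt, hvs⟩ := exists_mem_notMem_of_card_lt_card (by omega : s.card < t.card)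
  have hst : s = t.erase v := by
    refine eq_of_subset_of_card_le (fun x hx => mem_erase.2 ⟨fun h => hvs (h ▸ hx), h1 s hs hx⟩) ?_
    rw [card_erase_of_mem hvt, hsc]
  refine ⟨v, hvt, mem_fullFlags.2 ⟨fun r hr => ?_, fun h => h0 (mem_of_mem_erase h), ?_,
    fun r hr r' hr' => hch r (mem_of_mem_erase hr) r' (mem_of_mem_erase hr')⟩⟩
  · obtain ⟨hrt, hrC⟩ := mem_erase.1 hr
    rw [← hst]
    rcases hch r hrC s hs with h2 | h2
    · exact h2
    · have hlt : r.card < t.card := card_lt_card (ssubset_iff_subset_ne.2 ⟨h1 r hrC, hrt⟩)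
      exact (eq_of_subset_of_card_le h2 (by omega)).ge
  · rw [card_erase_of_mem htC, card_erase_of_mem hvt, hcard]

/-- Double counting: each point of `t ∩ B` survives all erasures but its own. -/
theorem sum_card_erase_inter (t B : Finset α) :
    ∑ v ∈ t, ((t.erase v) ∩ B).card = (t ∩ B).card * (t.card - 1) := by
  have h : ∀ v ∈ t, ((t.erase v) ∩ B).card + (if v ∈ B then 1 else 0) = (t ∩ B).card := by
    intro v hv
    rw [erase_inter]
    split_ifs with hB
    · exact card_erase_add_one (mem_inter.2 ⟨hv, hB⟩)
    · rw [erase_eq_of_notMem (fun h => hB (mem_inter.1 h).2), add_zero]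
  have h2 := sum_congr rfl h
  rw [sum_add_distrib, sum_boole, sum_const, smul_eq_mul, Nat.cast_id, filter_mem_eq_inter] at h2
  rw [Nat.mul_sub, mul_comm _ t.card]
  omega

/-- The number of maximal flags whose smallest member is a point of `B`. -/
theorem card_fullFlags_filter (t B : Finset α) :
    ((fullFlags t).filter fun C => ∃ v ∈ B, {v} ∈ C).card = (t ∩ B).card * (t.card - 1).factorial := by
  induction ht : t.card generalizing t with
  | zero =>
    rw [card_eq_zero] at ht
    subst ht
    simp only [empty_inter, card_empty, zero_mul, card_eq_zero]
    refine filter_eq_empty_iff.2 fun C hC => ?_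
    have : C = ∅ := card_eq_zero.1 (mem_fullFlags.1 hC).2.2.1
    simp [this]
  | succ n ih =>
    -- A one-point set is treated apart: removing its top member would also remove the smallest
    -- member of the flag.
    rcases Nat.eq_zero_or_pos n with rfl | hn
    · obtain ⟨a, rfl⟩ := card_eq_one.1 ht
      have hflag : fullFlags ({a} : Finset α) = {{{a}}} := by
        ext C
        rw [mem_singleton]
        constructor
        · intro hC
          have h1 := self_mem_of_mem_fullFlags (singleton_nonempty a) hC
          have h2 := (mem_fullFlags.1 hC).2.2.1
          rw [card_singleton] at h2
          obtain ⟨b, rfl⟩ := card_eq_one.1 h2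
          rw [mem_singleton.1 h1]
        · rintro rfl
          rw [mem_fullFlags]
          simp
      rw [hflag, filter_singleton]
      by_cases ha : a ∈ B <;> simp [ha]
    -- Removing the top member `t` matches the flags of `t` with pairs of a point `v` and a flag of
    -- `t.erase v`, and keeps the smallest member.
    · have hcard : ((fullFlags t).filter fun C => ∃ v ∈ B, {v} ∈ C).card
          = (t.sigma fun v =>
            (fullFlags (t.erase v)).filter fun C => ∃ v ∈ B, {v} ∈ C).card := by
        symm
        refine card_bij (fun p _ => insert t p.2) ?_ ?_ ?_
        · rintro ⟨v, C⟩ hp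
          obtain ⟨hv, hC⟩ := mem_sigma.1 hp
          obtain ⟨hC, w, hw, hwC⟩ := mem_filter.1 hC
          exact mem_filter.2 ⟨(insert_mem_fullFlags hv hC).2, w, hw, mem_insert_of_mem hwC⟩
        · rintro ⟨v, C⟩ hp ⟨v', C'⟩ hp' heq
          obtain ⟨hv, hC⟩ := mem_sigma.1 hp
          obtain ⟨hv', hC'⟩ := mem_sigma.1 hp'
          have hC := (mem_filter.1 hC).1
          have hC' := (mem_filter.1 hC').1
          have hCC : C = C' := (erase_insert (insert_mem_fullFlags hv hC).1).symm.trans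
            ((congrArg (fun D => D.erase t) heq).trans
              (erase_insert (insert_mem_fullFlags hv' hC').1))
          subst hCC
          have hne : (t.erase v).Nonempty := by
            rw [← card_pos, card_erase_of_mem hv, ht]
            exact hn
          have h3 := (mem_fullFlags.1 hC').1 _ (self_mem_of_mem_fullFlags hne hC)
          have hvv : v = v' := by
            by_contra hvv
            exact notMem_erase v' t (h3 (mem_erase.2 ⟨fun h => hvv h.symm, hv'⟩))
          subst hvv
          rfl
        · intro C hC
          obtain ⟨hC, w, hw, hwC⟩ := mem_filter.1 hC
          obtain ⟨v, hv, hvC⟩ := exists_erase_mem_fullFlags (by omega) hC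
          have htC : t ∈ C := self_mem_of_mem_fullFlags (card_pos.1 (by omega)) hC
          refine ⟨⟨v, C.erase t⟩, mem_sigma.2 ⟨hv, mem_filter.2 ⟨hvC, w, hw, mem_erase.2
            ⟨fun h => ?_, hwC⟩⟩⟩, insert_erase htC⟩
          rw [← h, card_singleton] at ht
          omega
      rw [hcard, card_sigma, sum_congr rfl fun v hv => ih (t.erase v)
        (by rw [card_erase_of_mem hv, ht]; rfl), ← sum_mul, sum_card_erase_inter, ht, mul_assoc]
      congr 1
      obtain ⟨k, rfl⟩ : ∃ k, n = k + 1 := ⟨n - 1, by omega⟩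
      rfl

theorem card_fullFlags (t : Finset α) : (fullFlags t).card = t.card.factorial := by
  rcases t.eq_empty_or_nonempty with rfl | ht
  · rfl
  · have h := card_fullFlags_filter t t
    rw [filter_true_of_mem, inter_self, Nat.mul_factorial_pred (card_pos.2 ht).ne'] at h
    · exact h
    · intro C hC
      obtain ⟨s, hs, hsc⟩ := exists_mem_card_eq_of_mem_fullFlags hC le_rfl (card_pos.2 ht)
      obtain ⟨v, rfl⟩ := card_eq_one.1 hsc
      exact ⟨v, (mem_fullFlags.1 hC).1 _ hs (mem_singleton_self v), hs⟩

end Finset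

/-! ### Simplices of the refinement as chains -/

namespace FiniteGraph

section Flags

open scoped Classical

variable (H : FiniteGraph.{u})

theorem Simplex.subset_or_subset {H : FiniteGraph.{u}} (C : H.refine.Simplex) {s t : H.Simplex}
    (hs : s ∈ C.1) (ht : t ∈ C.1) : s.1 ⊆ t.1 ∨ t.1 ⊆ s.1 := by
  by_cases h : s = t
  · exact Or.inl (h ▸ Finset.Subset.rfl)
  · exact (C.2.2 hs ht h).2

theorem Simplex.exists_top {H : FiniteGraph.{u}} (C : H.refine.Simplex) :
    ∃ t : H.Simplex, t ∈ C.1 ∧ ∀ s : H.Simplex, s ∈ C.1 → s.1 ⊆ t.1 := by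
  obtain ⟨t, ht, hmax⟩ := Finset.exists_max_image C.1 (fun s : H.Simplex => s.1.card) C.2.1
  refine ⟨t, ht, fun s hs => ?_⟩
  rcases C.subset_or_subset hs ht with h | h
  · exact h
  · exact (Finset.eq_of_subset_of_card_le h (hmax s hs)).ge

/-- The largest member of a chain of simplices. -/
noncomputable def Simplex.top {H : FiniteGraph.{u}} (C : H.refine.Simplex) : H.Simplex :=
  C.exists_top.choose

theorem Simplex.top_mem {H : FiniteGraph.{u}} (C : H.refine.Simplex) :
    (C.top : H.Simplex) ∈ C.1 := C.exists_top.choose_spec.1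

theorem Simplex.subset_top {H : FiniteGraph.{u}} (C : H.refine.Simplex) {s : H.Simplex}
    (hs : s ∈ C.1) : s.1 ⊆ C.top.1 := C.exists_top.choose_spec.2 s hs

theorem Simplex.top_eq {H : FiniteGraph.{u}} (C : H.refine.Simplex) {t : H.Simplex}
    (ht : t ∈ C.1) (h : ∀ s : H.Simplex, s ∈ C.1 → s.1 ⊆ t.1) : C.top = t :=
  Subtype.ext (Finset.Subset.antisymm (h _ C.top_mem) (C.subset_top ht))

/-- A chain of simplices as a family of vertex sets. -/
noncomputable def Simplex.family {H : FiniteGraph.{u}} (C : H.refine.Simplex) :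
    Finset (Finset H.V) :=
  Finset.image (fun s : H.Simplex => s.1) C.1

theorem Simplex.mem_family {H : FiniteGraph.{u}} {C : H.refine.Simplex} {r : Finset H.V} :
    r ∈ C.family ↔ ∃ s : H.Simplex, s ∈ C.1 ∧ s.1 = r := Finset.mem_image

theorem Simplex.family_injective {H : FiniteGraph.{u}} :
    Function.Injective (Simplex.family : H.refine.Simplex → _) := fun _ _ h =>
  Subtype.ext (Finset.image_injective Subtype.val_injective h)

theorem Simplex.card_family {H : FiniteGraph.{u}} (C : H.refine.Simplex) :
    C.family.card = C.1.card := Finset.card_image_of_injective _ Subtype.val_injective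

theorem Simplex.family_chain {H : FiniteGraph.{u}} (C : H.refine.Simplex) :
    ∀ r ∈ C.family, ∀ s ∈ C.family, r ⊆ s ∨ s ⊆ r := by
  intro r hr s hs
  obtain ⟨r', hr', rfl⟩ := mem_family.1 hr
  obtain ⟨s', hs', rfl⟩ := mem_family.1 hs
  exact C.subset_or_subset hr' hs'

theorem Simplex.empty_notMem_family {H : FiniteGraph.{u}} (C : H.refine.Simplex) :
    ∅ ∉ C.family := by
  intro h
  obtain ⟨r, -, hr⟩ := mem_family.1 h
  exact r.2.1.ne_empty hr

theorem Simplex.subset_of_mem_family {H : FiniteGraph.{u}} (C : H.refine.Simplex) :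
    ∀ r ∈ C.family, r ⊆ C.top.1 := by
  intro r hr
  obtain ⟨r', hr', rfl⟩ := mem_family.1 hr
  exact C.subset_top hr'

theorem Simplex.card_le_card_top {H : FiniteGraph.{u}} (C : H.refine.Simplex) :
    C.1.card ≤ C.top.1.card := by
  rw [← C.card_family]
  exact Finset.card_le_of_chain C.subset_of_mem_family C.empty_notMem_family C.family_chain

theorem Simplex.family_mem_fullFlags {H : FiniteGraph.{u}} (C : H.refine.Simplex)
    (h : C.1.card = C.top.1.card) : C.family ∈ Finset.fullFlags C.top.1 :=
  Finset.mem_fullFlags.2 ⟨C.subset_of_mem_family, C.empty_notMem_family,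
    by rw [C.card_family, h], C.family_chain⟩

/-- Every maximal flag of a simplex is a simplex of the barycentric refinement. -/
theorem Simplex.exists_family_eq {H : FiniteGraph.{u}} (t : H.Simplex) {F : Finset (Finset H.V)}
    (hF : F ∈ Finset.fullFlags t.1) :
    ∃ C : H.refine.Simplex, C.top = t ∧ C.1.card = t.1.card ∧ C.family = F := by
  obtain ⟨h1, h0, hcard, hch⟩ := Finset.mem_fullFlags.1 hF
  have htF := Finset.self_mem_of_mem_fullFlags t.2.1 hF
  let c : Finset H.Simplex := Finset.univ.filter fun s => s.1 ∈ F
  have hc : ∀ s : H.Simplex, s ∈ c ↔ s.1 ∈ F := fun s => by simp [c]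
  have hct : t ∈ c := (hc t).2 htF
  let C : H.refine.Simplex := ⟨c, ⟨t, hct⟩, fun r hr s hs hne =>
    ⟨hne, hch _ ((hc r).1 hr) _ ((hc s).1 hs)⟩⟩
  have hfam : C.family = F := by
    ext r
    rw [mem_family]
    constructor
    · rintro ⟨s, hs, rfl⟩
      exact (hc s).1 hs
    · intro hr
      have hne : r.Nonempty := Finset.nonempty_iff_ne_empty.2 fun h => h0 (h ▸ hr)
      exact ⟨⟨r, hne, t.2.2.subset (by exact_mod_cast h1 r hr)⟩, (hc _).2 hr, rfl⟩
  refine ⟨C, C.top_eq hct fun s hs => h1 _ ((hc s).1 hs), ?_, hfam⟩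
  rw [← C.card_family, hfam, hcard]

/-- Transfer of a weighted simplex count to the barycentric refinement: the flags of full length
dominate. -/
theorem sum_pow_card_refine_le {D : ℕ} (hD : ∀ s : H.Simplex, s.1.card ≤ D)
    {P : H.refine.Simplex → Prop} {Q : H.Simplex → Prop} (hPQ : ∀ C, P C → Q C.top) {μ : ℕ}
    (hμ : ∀ t, Q t →
      (Finset.univ.filter fun C => P C ∧ C.top = t ∧ C.1.card = t.1.card).card ≤ μ)
    {M : ℝ} (hM : 1 ≤ M) :
    ∑ C with P C, M ^ C.1.card
      ≤ (μ + (2 ^ (2 ^ D) : ℕ) / M) * ∑ t with Q t, M ^ t.1.card := by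
  have hM0 : 0 < M := one_pos.trans_le hM
  rw [← Finset.sum_fiberwise_of_maps_to (s := Finset.univ.filter P) (t := Finset.univ.filter Q)
    (g := Simplex.top) (fun C hC => by simpa using hPQ C (Finset.mem_filter.1 hC).2), Finset.mul_sum]
  refine Finset.sum_le_sum fun t ht => ?_
  have hQ := (Finset.mem_filter.1 ht).2
  let 𝒞 := (Finset.univ.filter P).filter fun C => C.top = t
  -- A chain shorter than its top simplex loses at least one factor `M`.
  have hterm : ∀ C ∈ 𝒞, M ^ C.1.card ≤
      (if C.1.card = t.1.card then M ^ t.1.card else 0) + M ^ t.1.card / M := by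
    intro C hC
    have hCt := (Finset.mem_filter.1 hC).2
    have hle := C.card_le_card_top
    rw [hCt] at hle
    split_ifs with h
    · rw [h]
      exact le_add_of_nonneg_right (by positivity)
    · rw [zero_add, le_div_iff₀ hM0, ← pow_succ]
      exact pow_le_pow_right₀ hM (by omega)
  have hcard1 : (𝒞.filter fun C => C.1.card = t.1.card).card ≤ μ := by
    refine le_trans (Finset.card_le_card fun C hC => ?_) (hμ t hQ)
    simp only [𝒞, Finset.mem_filter, Finset.mem_univ, true_and] at hC ⊢
    exact ⟨hC.1.1, hC.1.2, hC.2⟩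
  -- A crude bound suffices here: it counts all families of subsets of `t`, and it will be divided
  -- by `M`.
  have hcard2 : 𝒞.card ≤ 2 ^ (2 ^ D) := by
    calc 𝒞.card ≤ t.1.powerset.powerset.card := by
          refine Finset.card_le_card_of_injOn Simplex.family (fun C hC => ?_)
            Simplex.family_injective.injOn
          have hCt := (Finset.mem_filter.1 hC).2
          rw [Finset.mem_coe, Finset.mem_powerset]
          intro r hr
          rw [Finset.mem_powerset, ← hCt]
          exact C.subset_of_mem_family r hr
      _ = 2 ^ (2 ^ t.1.card) := by rw [Finset.card_powerset, Finset.card_powerset]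
      _ ≤ 2 ^ (2 ^ D) :=
          Nat.pow_le_pow_right two_pos (Nat.pow_le_pow_right two_pos (hD t))
  calc ∑ C ∈ 𝒞, M ^ C.1.card
      ≤ ∑ C ∈ 𝒞, ((if C.1.card = t.1.card then M ^ t.1.card else 0) + M ^ t.1.card / M) :=
        Finset.sum_le_sum hterm
    _ = (𝒞.filter fun C => C.1.card = t.1.card).card * M ^ t.1.card
          + 𝒞.card * (M ^ t.1.card / M) := by
        rw [Finset.sum_add_distrib, Finset.sum_const, nsmul_eq_mul, ← Finset.sum_filter,
          Finset.sum_const, nsmul_eq_mul]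
    _ ≤ μ * M ^ t.1.card + (2 ^ (2 ^ D) : ℕ) * (M ^ t.1.card / M) := by gcongr
    _ = _ := by ring

theorem card_full_chains_le {P : H.refine.Simplex → Prop} (B : Finset H.V)
    (hP : ∀ C, P C → C.1.card = C.top.1.card → ∃ v ∈ B, {v} ∈ C.family) (t : H.Simplex) :
    (Finset.univ.filter fun C => P C ∧ C.top = t ∧ C.1.card = t.1.card).card
      ≤ (t.1 ∩ B).card * (t.1.card - 1).factorial := by
  rw [← Finset.card_fullFlags_filter]
  refine Finset.card_le_card_of_injOn Simplex.family (fun C hC => ?_)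
    Simplex.family_injective.injOn
  obtain ⟨hPC, rfl, hcard⟩ := (Finset.mem_filter.1 hC).2
  exact Finset.mem_filter.2 ⟨C.family_mem_fullFlags hcard, hP C hPC hcard⟩

/-- Every `t` with `k` vertices is the top of `k!` full chains, and a chain determines its top. -/
theorem factorial_mul_card_le (k : ℕ) :
    k.factorial * (Finset.univ.filter fun t : H.Simplex => t.1.card = k).card
      ≤ (Finset.univ.filter fun C : H.refine.Simplex => C.1.card = k).card := by
  have hcover : ((Finset.univ.filter fun t : H.Simplex => t.1.card = k).sigma fun t =>
      Finset.fullFlags t.1).card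
        ≤ (Finset.univ.filter fun C : H.refine.Simplex => C.1.card = k).card := by
    refine Finset.card_le_card_of_surjOn
      (fun C => (⟨C.top, C.family⟩ : (_ : H.Simplex) × Finset (Finset H.V))) ?_
    rintro ⟨t, F⟩ hF
    obtain ⟨ht, hF⟩ := Finset.mem_sigma.1 hF
    obtain ⟨C, rfl, hcard, rfl⟩ := t.exists_family_eq hF
    refine ⟨C, ?_, rfl⟩
    have := (Finset.mem_filter.1 ht).2
    simp [hcard, this]
  refine le_trans (le_of_eq ?_) hcover
  rw [Finset.card_sigma, Finset.sum_congr rfl fun t ht => by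
    rw [Finset.card_fullFlags, (Finset.mem_filter.1 ht).2], Finset.sum_const, smul_eq_mul, mul_comm]

end Flags

/-! ### Carriers and the boundary -/

section Carrier

open scoped Classical

variable {α : Type*}

/-- The carrier of a vertex of the refinement, if the vertices of the graph have carriers. -/
noncomputable def refineCarrier (H : FiniteGraph.{u}) (c : H.V → Finset α) (s : H.Simplex) :
    Finset α :=
  s.1.biUnion c

variable {H : FiniteGraph.{u}} {c : H.V → Finset α}

/-- Carriers grow along a chain. Consequently, in a refinement, some vertex of each simplex has the
same carrier as the whole simplex. -/
theorem biUnion_refineCarrier (C : H.refine.Simplex) :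
    C.1.biUnion (H.refineCarrier c) = H.refineCarrier c C.top := by
  refine Finset.Subset.antisymm (Finset.biUnion_subset.2 fun s hs => ?_)
    (Finset.subset_biUnion_of_mem _ C.top_mem)
  exact Finset.biUnion_subset_biUnion_of_subset_left c (C.subset_top hs)

/-- A simplex meets the boundary if it has a vertex whose carrier has fewer than `k` elements. -/
def Touches (c : H.V → Finset α) (k : ℕ) (s : H.Simplex) : Prop := ∃ x ∈ s.1, (c x).card < k

theorem Touches.of_refine {k : ℕ} {C : H.refine.Simplex}
    (h : Touches (H := H.refine) (H.refineCarrier c) k C) :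
    ∃ s : H.Simplex, s ∈ C.1 ∧ ∀ x ∈ s.1, (c x).card < k := by
  obtain ⟨s, hs, hsk⟩ := h
  exact ⟨s, hs, fun x hx =>
    (Finset.card_le_card (Finset.subset_biUnion_of_mem c hx)).trans_lt hsk⟩

theorem Touches.top {k : ℕ} {C : H.refine.Simplex}
    (h : Touches (H := H.refine) (H.refineCarrier c) k C) : Touches c k C.top := by
  obtain ⟨s, hs, hsk⟩ := h.of_refine
  obtain ⟨x, hx⟩ := s.2.1
  exact ⟨x, C.subset_top hs hx, hsk x hx⟩

/-- A full chain begins with a single vertex. It lies in every member of the chain, in particular in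
one whose vertices all have small carriers. -/
theorem Touches.exists_singleton {k : ℕ} {C : H.refine.Simplex}
    (h : Touches (H := H.refine) (H.refineCarrier c) k C) (hC : C.1.card = C.top.1.card) :
    ∃ v ∈ Finset.univ.filter fun v => (c v).card < k, {v} ∈ C.family := by
  obtain ⟨s, hs, hsk⟩ := h.of_refine
  obtain ⟨r, hr, hrc⟩ := Finset.exists_mem_card_eq_of_mem_fullFlags (C.family_mem_fullFlags hC)
    le_rfl (Finset.card_pos.2 C.top.2.1)
  obtain ⟨v, rfl⟩ := Finset.card_eq_one.1 hrc
  refine ⟨v, Finset.mem_filter.2 ⟨Finset.mem_univ _, hsk v ?_⟩, hr⟩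
  rcases C.family_chain _ hr _ (Simplex.mem_family.2 ⟨s, hs, rfl⟩) with h1 | h1
  · exact h1 (Finset.mem_singleton_self v)
  · obtain ⟨x, hx⟩ := s.2.1
    rwa [← Finset.mem_singleton.1 (h1 hx)]

end Carrier

end FiniteGraph

/-! ### Growth of the weighted simplex counts -/

namespace FiniteGraph

section Growth

open scoped Classical

variable {α : Type*} {H : FiniteGraph.{u}} {c : H.V → Finset α}

/-- Every simplex has at most as many vertices as its carrier, and its carrier is admissible. -/
structure IsCarrier (c : H.V → Finset α) (Adm : Finset α → Prop) : Prop where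
  card_le : ∀ s : H.Simplex, s.1.card ≤ (H.refineCarrier c s).card
  adm : ∀ s : H.Simplex, Adm (H.refineCarrier c s)

theorem IsCarrier.refine {Adm : Finset α → Prop} (h : IsCarrier c Adm) :
    IsCarrier (H := H.refine) (H.refineCarrier c) Adm where
  card_le C := by
    refine le_trans ?_ (congrArg Finset.card (biUnion_refineCarrier C)).ge
    exact C.card_le_card_top.trans (h.card_le _)
  adm C := by
    have := h.adm C.top
    rwa [← biUnion_refineCarrier C] at this

/-- The weighted number of all simplices. -/
noncomputable def totalWeight (H : FiniteGraph.{u}) (M : ℝ) : ℝ := ∑ s : H.Simplex, M ^ s.1.card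

/-- The weighted number of simplices which meet the boundary. -/
noncomputable def boundaryWeight (c : H.V → Finset α) (k : ℕ) (M : ℝ) : ℝ :=
  ∑ s : H.Simplex with Touches c k s, M ^ s.1.card

theorem totalWeight_refine_le {D : ℕ} (hD : ∀ s : H.Simplex, s.1.card ≤ D) {M : ℝ} (hM : 1 ≤ M) :
    H.refine.totalWeight M ≤ (D.factorial + (2 ^ (2 ^ D) : ℕ) / M) * H.totalWeight M := by
  have h := H.sum_pow_card_refine_le hD (P := fun _ => True) (Q := fun _ => True)
    (fun _ _ => trivial) (μ := D.factorial) (fun t _ => ?_) hM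
  · simpa [totalWeight] using h
  · refine (H.card_full_chains_le Finset.univ (fun C _ hC => ?_) t).trans ?_
    · obtain ⟨s, hs, hsc⟩ := Finset.exists_mem_card_eq_of_mem_fullFlags
        (C.family_mem_fullFlags hC) le_rfl (Finset.card_pos.2 C.top.2.1)
      obtain ⟨v, rfl⟩ := Finset.card_eq_one.1 hsc
      exact ⟨v, Finset.mem_univ _, hs⟩
    · rw [Finset.inter_univ, Nat.mul_factorial_pred (Finset.card_pos.2 t.2.1).ne']
      exact Nat.factorial_le (hD t)

/-- The source of the exponential rate. In a simplex with `d + 1` vertices, the vertex supplied by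
`hatt` has a carrier of full size, so at most `d` vertices are boundary vertices; smaller simplices
have at most `d` vertices anyway. Hence at most `d * d!` full chains of a simplex touch the
boundary. -/
theorem boundaryWeight_refine_le {d : ℕ} {Adm : Finset α → Prop} (hc : IsCarrier c Adm)
    (hAdm : ∀ s, Adm s → s.card ≤ d + 1)
    (hatt : ∀ s : H.Simplex, ∃ x ∈ s.1, c x = H.refineCarrier c s) {M : ℝ} (hM : 1 ≤ M) :
    boundaryWeight (H := H.refine) (H.refineCarrier c) (d + 1) M
      ≤ ((d * d.factorial : ℕ) + (2 ^ (2 ^ (d + 1)) : ℕ) / M) * boundaryWeight c (d + 1) M := by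
  have hD : ∀ s : H.Simplex, s.1.card ≤ d + 1 := fun s => (hc.card_le s).trans (hAdm _ (hc.adm s))
  refine H.sum_pow_card_refine_le hD (fun C hC => hC.top) (fun t _ => ?_) hM
  refine (H.card_full_chains_le _ (fun C hP hC => hP.exists_singleton hC) t).trans ?_
  refine Nat.mul_le_mul ?_ (Nat.factorial_le (by have := hD t; omega))
  rcases Nat.lt_or_ge t.1.card (d + 1) with hlt | hge
  · exact (Finset.card_le_card Finset.inter_subset_left).trans (by omega)
  · obtain ⟨x, hx, hxc⟩ := hatt t
    have hlt : (t.1 ∩ Finset.univ.filter fun v => (c v).card < d + 1).card < t.1.card := by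
      refine Finset.card_lt_card (Finset.ssubset_iff_of_subset Finset.inter_subset_left |>.2
        ⟨x, hx, fun h => ?_⟩)
      have h1 := (Finset.mem_filter.1 (Finset.mem_inter.1 h).2).2
      have h2 := hc.card_le t
      rw [← hxc] at h2
      omega
    have := hD t
    omega

end Growth

/-- The successive barycentric refinements, by recursion on their number. -/
noncomputable def subdivision (G : FiniteGraph.{u}) : ℕ → FiniteGraph.{u}
  | 0 => G
  | m + 1 => (subdivision G m).refine

theorem iterRefine_eq_subdivision (G : FiniteGraph.{u}) (m : ℕ) :
    G.iterRefine m = G.subdivision m := by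
  induction m with
  | zero => rfl
  | succ m ih => rw [iterRefine, Function.iterate_succ_apply', subdivision, ← ih, iterRefine]

theorem subdivision_refine (G : FiniteGraph.{u}) (m : ℕ) :
    G.refine.subdivision m = G.subdivision (m + 1) := by
  rw [← iterRefine_eq_subdivision, ← iterRefine_eq_subdivision]
  rfl

/-- The carrier of a vertex of the `m`-th refinement: the vertices of the smallest simplex of the
original graph which contains it. -/
noncomputable def carrier (G : FiniteGraph.{u}) : ∀ m, (G.subdivision m).V → Finset G.V
  | 0 => fun v => {v}
  | m + 1 => (G.subdivision m).refineCarrier (G.carrier m)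

section Subdivision

open scoped Classical

variable (G : FiniteGraph.{u})

theorem isCarrier_carrier (m : ℕ) :
    IsCarrier (H := G.subdivision m) (G.carrier m) fun s => G.graph.IsClique (s : Set G.V) := by
  induction m with
  | zero =>
    have h : ∀ s : G.Simplex, refineCarrier G (G.carrier 0) s = s.1 := fun s =>
      Finset.biUnion_singleton_eq_self
    exact ⟨fun s => (congrArg Finset.card (h s)).ge, fun s => by
      have := s.2.2
      rwa [← h s] at this⟩
  | succ m ih => exact ih.refine

/-- Before any refinement carriers are singletons and this fails for edges; therefore the boundary
estimates start at the first refinement. -/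
theorem exists_carrier_eq (m : ℕ) (s : (G.subdivision (m + 1)).Simplex) :
    ∃ x ∈ s.1, G.carrier (m + 1) x = (G.subdivision (m + 1)).refineCarrier (G.carrier (m + 1)) s :=
  ⟨Simplex.top (H := G.subdivision m) s, Simplex.top_mem (H := G.subdivision m) s,
    (biUnion_refineCarrier (H := G.subdivision m) s).symm⟩

variable {G} {d : ℕ} (hG : ∀ s : Finset G.V, G.graph.IsClique (s : Set G.V) → s.card ≤ d + 1)

include hG in
theorem card_simplex_le (m : ℕ) (s : (G.subdivision m).Simplex) : s.1.card ≤ d + 1 :=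
  ((G.isCarrier_carrier m).card_le s).trans (hG _ ((G.isCarrier_carrier m).adm s))

theorem factorial_pow_le_card (hG' : ∃ s : Finset G.V, G.graph.IsNClique (d + 1) s) (m : ℕ) :
    (d + 1).factorial ^ m
      ≤ (Finset.univ.filter fun s : (G.subdivision m).Simplex => s.1.card = d + 1).card := by
  induction m with
  | zero =>
    obtain ⟨s, hs⟩ := hG'
    rw [pow_zero, Nat.one_le_iff_ne_zero, ← Nat.pos_iff_ne_zero, Finset.card_pos]
    have hne : s.Nonempty := Finset.card_pos.1 (by rw [hs.card_eq]; omega)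
    exact ⟨⟨s, hne, hs.isClique⟩, Finset.mem_filter.2 ⟨Finset.mem_univ _, hs.card_eq⟩⟩
  | succ m ih =>
    rw [pow_succ, mul_comm]
    exact (Nat.mul_le_mul_left _ ih).trans ((G.subdivision m).factorial_mul_card_le (d + 1))

/-- The base of the simplex weights. -/
noncomputable def weightBase (d : ℕ) : ℝ := 4 * (2 ^ (2 ^ (d + 1)) : ℕ)

theorem one_le_weightBase (d : ℕ) : 1 ≤ weightBase d := by
  have : (1 : ℝ) ≤ (2 ^ (2 ^ (d + 1)) : ℕ) := by exact_mod_cast Nat.one_le_two_pow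
  rw [weightBase]
  linarith

/-- The base is chosen so that all shorter chains together add only `1 / 4` to the growth factors.
-/
theorem div_weightBase (d : ℕ) : ((2 ^ (2 ^ (d + 1)) : ℕ) : ℝ) / weightBase d = 1 / 4 := by
  have : ((2 ^ (2 ^ (d + 1)) : ℕ) : ℝ) ≠ 0 := by positivity
  rw [weightBase]
  field_simp

include hG in
theorem totalWeight_subdivision_le (m : ℕ) :
    (G.subdivision m).totalWeight (weightBase d)
      ≤ G.totalWeight (weightBase d) * ((d + 1).factorial + 1 / 4 : ℝ) ^ m := by
  induction m with
  | zero => simp [subdivision]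
  | succ m ih =>
    refine (totalWeight_refine_le (card_simplex_le hG m) (one_le_weightBase d)).trans ?_
    rw [div_weightBase, pow_succ, ← mul_assoc, mul_comm]
    exact mul_le_mul_of_nonneg_right ih (by positivity)

include hG in
theorem boundaryWeight_subdivision_le (m : ℕ) :
    boundaryWeight (G.carrier (m + 1)) (d + 1) (weightBase d)
      ≤ boundaryWeight (G.carrier 1) (d + 1) (weightBase d)
        * ((d * d.factorial : ℕ) + 1 / 4 : ℝ) ^ m := by
  induction m with
  | zero => simp
  | succ m ih =>
    refine (boundaryWeight_refine_le (H := G.subdivision (m + 1)) (G.isCarrier_carrier (m + 1)) hG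
      (G.exists_carrier_eq m) (one_le_weightBase d)).trans ?_
    rw [div_weightBase, pow_succ, ← mul_assoc, mul_comm]
    exact mul_le_mul_of_nonneg_right ih (by positivity)

end Subdivision

/-! ### Vertices and edges bounded by simplex weights -/

section Counts

open scoped Classical

variable {α : Type*} {H : FiniteGraph.{u}} {M : ℝ} (hM : 1 ≤ M)

/-- The simplex which consists of a single vertex. -/
def vertexSimplex (x : H.V) : H.Simplex := ⟨{x}, Finset.singleton_nonempty x, by simp⟩

/-- The simplex which consists of the endpoints of an edge. -/
noncomputable def edgeSimplex {x y : H.V} (h : H.graph.Adj x y) : H.Simplex :=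
  ⟨{x, y}, Finset.insert_nonempty _ _, by
    rw [Finset.coe_insert, Finset.coe_singleton, SimpleGraph.isClique_pair]
    exact fun _ => h⟩

include hM in
-- Edges are two-vertex simplices, and every simplex has weight at least `1`.
theorem ncard_le_sum_pow {P : H.Simplex → Prop} {E : Set (Sym2 H.V)}
    (hE : ∀ x y, s(x, y) ∈ E → ∃ h : H.graph.Adj x y, P (edgeSimplex h)) :
    (E.ncard : ℝ) ≤ ∑ s : H.Simplex with P s, M ^ s.1.card := by
  have h1 : E.ncard ≤ (Finset.univ.filter P).card := by
    refine le_trans ?_ (Finset.card_image_le (f := fun s : H.Simplex => s.1))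
    rw [← Set.ncard_coe_finset]
    refine Set.ncard_le_ncard_of_injOn Sym2.toFinset (fun e => ?_) (fun e _ e' _ h => ?_)
      (Set.toFinite _)
    · induction e with
      | h x y =>
        intro he
        obtain ⟨h, hP⟩ := hE x y he
        rw [Sym2.toFinset_mk_eq]
        exact Finset.mem_coe.2 (Finset.mem_image.2
          ⟨edgeSimplex h, Finset.mem_filter.2 ⟨Finset.mem_univ _, hP⟩, rfl⟩)
    · refine Sym2.ext fun x => ?_
      rw [← Sym2.mem_toFinset, ← Sym2.mem_toFinset, h]
  refine le_trans (Nat.cast_le.2 h1) ?_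
  rw [← nsmul_one, ← Finset.sum_const]
  exact Finset.sum_le_sum fun s _ => one_le_pow₀ hM

include hM in
theorem card_le_sum_pow {P : H.Simplex → Prop} {Z : Type*} [Fintype Z] (f : Z → H.V)
    (hf : Function.Injective f) (hP : ∀ z, P (vertexSimplex (f z))) :
    (Fintype.card Z : ℝ) ≤ ∑ s : H.Simplex with P s, M ^ s.1.card := by
  have h1 : Fintype.card Z ≤ (Finset.univ.filter P).card := by
    rw [← Finset.card_univ]
    refine Finset.card_le_card_of_injOn (fun z => vertexSimplex (f z))
      (fun z _ => Finset.mem_filter.2 ⟨Finset.mem_univ _, hP z⟩) (fun z _ z' _ h => hf ?_)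
    exact Finset.singleton_injective (congrArg Subtype.val h)
  refine le_trans (Nat.cast_le.2 h1) ?_
  rw [← nsmul_one, ← Finset.sum_const]
  exact Finset.sum_le_sum fun s _ => one_le_pow₀ hM

end Counts

end FiniteGraph

/-! ### Embeddings and the interiors of simplices -/

namespace FiniteGraph

universe v

section Embedding

open scoped Classical

variable {A : FiniteGraph.{v}} {B : FiniteGraph.{u}}

/-- An embedding of graphs induces an embedding of the barycentric refinements. -/
noncomputable def refineEmbedding (φ : A.graph ↪g B.graph) : A.refine.graph ↪g B.refine.graph where
  toFun := fun s : A.Simplex => (⟨s.1.map φ.toEmbedding, s.2.1.map, by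
    rw [Finset.coe_map]
    rintro _ ⟨x, hx, rfl⟩ _ ⟨y, hy, rfl⟩ hxy
    exact φ.map_rel_iff.2 (s.2.2 hx hy fun h => hxy (h ▸ rfl))⟩ : B.Simplex)
  inj' := fun s t h => Subtype.ext (Finset.map_injective φ.toEmbedding (congrArg Subtype.val h))
  map_rel_iff' := by
    intro s t
    refine and_congr (not_congr ⟨fun h => ?_, fun h => by rw [h]⟩)
      (or_congr Finset.map_subset_map Finset.map_subset_map)
    exact Subtype.ext (Finset.map_injective φ.toEmbedding (congrArg Subtype.val h))

theorem exists_refineEmbedding_eq (φ : A.graph ↪g B.graph) (t : B.Simplex)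
    (ht : ∀ y ∈ t.1, y ∈ Set.range φ) : ∃ s : A.Simplex, refineEmbedding φ s = t := by
  have hmap : (Finset.univ.filter fun x => φ x ∈ t.1).map φ.toEmbedding = t.1 := by
    ext y
    simp only [Finset.mem_map, Finset.mem_filter, Finset.mem_univ, true_and]
    constructor
    · rintro ⟨x, hx, rfl⟩
      exact hx
    · intro hy
      obtain ⟨x, rfl⟩ := ht y hy
      exact ⟨x, hy, rfl⟩
  refine ⟨⟨Finset.univ.filter fun x => φ x ∈ t.1, ?_, ?_⟩, Subtype.ext hmap⟩
  · obtain ⟨y, hy⟩ := t.2.1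
    obtain ⟨x, rfl⟩ := ht y hy
    exact ⟨x, by simpa using hy⟩
  · intro x hx y hy hxy
    have hx' : φ x ∈ t.1 := by simpa using hx
    have hy' : φ y ∈ t.1 := by simpa using hy
    exact φ.map_rel_iff.1 (t.2.2 hx' hy' fun h => hxy (φ.injective h))

/-- An embedding of graphs induces embeddings of all successive barycentric refinements. -/
noncomputable def subdivisionEmbedding (φ : A.graph ↪g B.graph) :
    ∀ m, (A.subdivision m).graph ↪g (B.subdivision m).graph
  | 0 => φ
  | m + 1 => refineEmbedding (subdivisionEmbedding φ m)

theorem carrier_subdivisionEmbedding (φ : A.graph ↪g B.graph) (m : ℕ) (x : (A.subdivision m).V) :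
    B.carrier m (subdivisionEmbedding φ m x) = (A.carrier m x).map φ.toEmbedding := by
  induction m with
  | zero => exact (Finset.map_singleton φ.toEmbedding x).symm
  | succ m ih =>
    ext y
    constructor
    · intro hy
      obtain ⟨z, hz, hyz⟩ := Finset.mem_biUnion.1 hy
      obtain ⟨w, hw, rfl⟩ := Finset.mem_map.1 hz
      have hyz' : y ∈ (A.carrier m w).map φ.toEmbedding := by rwa [← ih]
      obtain ⟨v, hv, rfl⟩ := Finset.mem_map.1 hyz'
      exact Finset.mem_map_of_mem _ (Finset.mem_biUnion.2 ⟨w, hw, hv⟩)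
    · intro hy
      obtain ⟨v, hv, rfl⟩ := Finset.mem_map.1 hy
      obtain ⟨w, hw, hvw⟩ := Finset.mem_biUnion.1 hv
      refine Finset.mem_biUnion.2 ⟨subdivisionEmbedding φ m w, Finset.mem_map_of_mem _ hw, ?_⟩
      rw [ih]
      exact Finset.mem_map_of_mem _ hvw

/-- The carriers of the members of `y` lie in the carrier of `y`, so the induction descends. For a
clique embedding, the vertices carried by the clique are thus exactly those of its own refinement.
-/
theorem exists_subdivisionEmbedding_eq (φ : A.graph ↪g B.graph) (m : ℕ) (y : (B.subdivision m).V)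
    (hy : ∀ v ∈ B.carrier m y, v ∈ Set.range φ) : ∃ x, subdivisionEmbedding φ m x = y := by
  induction m with
  | zero => exact hy y (Finset.mem_singleton_self y)
  | succ m ih =>
    exact exists_refineEmbedding_eq _ y fun z hz => ih z fun v hv =>
      hy v (Finset.mem_biUnion.2 ⟨z, hz, hv⟩)

end Embedding

/-- The complete graph with `d + 1` vertices. -/
def fullSimplex (d : ℕ) : FiniteGraph.{0} := ⟨Fin (d + 1), inferInstance, ⊤⟩

open scoped Classical in
/-- The graph of the interior vertices of the `m`-th refinement of the complete graph. -/
noncomputable def interior (d m : ℕ) : FiniteGraph.{0} where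
  V := {x : ((fullSimplex d).subdivision m).V // ((fullSimplex d).carrier m x).card = d + 1}
  fintypeV := inferInstance
  graph := ((fullSimplex d).subdivision m).graph.comap Subtype.val

section Copies

open scoped Classical

variable {G : FiniteGraph.{u}} {d : ℕ}

/-- A complete subgraph as an embedding of the complete graph. -/
noncomputable def cliqueEmbedding (s : {s : Finset G.V // G.graph.IsNClique (d + 1) s}) :
    (fullSimplex d).graph ↪g G.graph where
  toFun := fun i : Fin (d + 1) => ((s.1.equivFinOfCardEq s.2.card_eq).symm i : G.V)
  inj' := fun i j h => (s.1.equivFinOfCardEq s.2.card_eq).symm.injective (Subtype.ext h)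
  map_rel_iff' := by
    intro i j
    constructor
    · intro h hij
      exact h.ne (by rw [hij])
    · intro h
      refine s.2.isClique (Finset.coe_mem _) (Finset.coe_mem _) fun hij => h ?_
      exact (s.1.equivFinOfCardEq s.2.card_eq).symm.injective (Subtype.ext hij)

theorem map_cliqueEmbedding (s : {s : Finset G.V // G.graph.IsNClique (d + 1) s})
    {t : Finset (fullSimplex d).V} (ht : t.card = d + 1) :
    t.map (cliqueEmbedding s).toEmbedding = s.1 := by
  refine Finset.eq_of_subset_of_card_le (fun x hx => ?_) ?_
  · obtain ⟨i, -, rfl⟩ := Finset.mem_map.1 hx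
    exact Finset.coe_mem _
  · rw [Finset.card_map, ht, s.2.card_eq]

theorem mem_range_cliqueEmbedding (s : {s : Finset G.V // G.graph.IsNClique (d + 1) s}) {x : G.V}
    (hx : x ∈ s.1) : x ∈ Set.range (cliqueEmbedding s) := by
  refine ⟨(s.1.equivFinOfCardEq s.2.card_eq) ⟨x, hx⟩, ?_⟩
  change (((s.1.equivFinOfCardEq s.2.card_eq).symm ((s.1.equivFinOfCardEq s.2.card_eq) ⟨x, hx⟩)
    : {y // y ∈ s.1}) : G.V) = x
  rw [Equiv.symm_apply_apply]

theorem carrier_isClique (m : ℕ) (x : (G.subdivision m).V) :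
    G.graph.IsClique (G.carrier m x : Set G.V) := by
  have h := (G.isCarrier_carrier m).adm (vertexSimplex x)
  rwa [refineCarrier, vertexSimplex, Finset.singleton_biUnion] at h

/-- The union of the two carriers is a clique, so it has at most `d + 1` elements and both carriers
fill it. No edge joins the interiors of different simplices. -/
theorem carrier_eq_of_adj (hG : ∀ s : Finset G.V, G.graph.IsClique (s : Set G.V) → s.card ≤ d + 1)
    {m : ℕ} {x y : (G.subdivision m).V} (h : (G.subdivision m).graph.Adj x y)
    (hx : (G.carrier m x).card = d + 1) (hy : (G.carrier m y).card = d + 1) :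
    G.carrier m x = G.carrier m y := by
  have hle := hG _ ((G.isCarrier_carrier m).adm (edgeSimplex h))
  have hx' : G.carrier m x ⊆ (G.subdivision m).refineCarrier (G.carrier m) (edgeSimplex h) :=
    Finset.subset_biUnion_of_mem (G.carrier m)
      (show x ∈ (edgeSimplex h).1 from Finset.mem_insert_self _ _)
  have hy' : G.carrier m y ⊆ (G.subdivision m).refineCarrier (G.carrier m) (edgeSimplex h) :=
    Finset.subset_biUnion_of_mem (G.carrier m)
      (show y ∈ (edgeSimplex h).1 from Finset.mem_insert_of_mem (Finset.mem_singleton_self _))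
  rw [Finset.eq_of_subset_of_card_le hx' (by omega), Finset.eq_of_subset_of_card_le hy' (by omega)]

/-- The refinement without the edges which meet the boundary. -/
def interiorEdges (G : FiniteGraph.{u}) (d m : ℕ) : SimpleGraph (G.subdivision m).V where
  Adj x y := (G.subdivision m).graph.Adj x y ∧ (G.carrier m x).card = d + 1 ∧
    (G.carrier m y).card = d + 1
  symm := ⟨fun _ _ h => ⟨h.1.symm, h.2.2, h.2.1⟩⟩
  loopless := ⟨fun x h => (G.subdivision m).graph.loopless.irrefl x h.1⟩

/-- The vertices of the refinement are the interior vertices of the simplices of dimension `d` and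
the boundary vertices. -/
noncomputable def copiesEquiv (G : FiniteGraph.{u}) (d m : ℕ) :
    ((interior d m).V × {s : Finset G.V // G.graph.IsNClique (d + 1) s}) ⊕
      {x : (G.subdivision m).V // (G.carrier m x).card ≠ d + 1} ≃ (G.subdivision m).V := by
  have hc : ∀ (x : (interior d m).V) (s : {s : Finset G.V // G.graph.IsNClique (d + 1) s}),
      G.carrier m (subdivisionEmbedding (cliqueEmbedding s) m x.1) = s.1 := fun x s => by
    rw [carrier_subdivisionEmbedding, map_cliqueEmbedding s x.2]
  refine Equiv.ofBijective
    (Sum.elim (fun p => subdivisionEmbedding (cliqueEmbedding p.2) m p.1.1) Subtype.val) ⟨?_, ?_⟩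
  · rintro (⟨x, s⟩ | z) (⟨y, t⟩ | w) h
    · have hst : s = t := Subtype.ext (by
        rw [← hc x s, ← hc y t]
        exact congrArg _ h)
      subst hst
      have hxy : x = y := Subtype.ext ((subdivisionEmbedding (cliqueEmbedding s) m).injective h)
      rw [hxy]
    · exact absurd (by rw [← show _ = w.1 from h]; exact (congrArg _ (hc x s)).trans s.2.card_eq) w.2
    · exact absurd (by rw [show z.1 = _ from h]; exact (congrArg _ (hc y t)).trans t.2.card_eq) z.2
    · rw [Subtype.ext h]
  · intro y
    by_cases hy : (G.carrier m y).card = d + 1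
    · let s : {s : Finset G.V // G.graph.IsNClique (d + 1) s} :=
        ⟨G.carrier m y, carrier_isClique m y, hy⟩
      obtain ⟨x, hx⟩ := exists_subdivisionEmbedding_eq (cliqueEmbedding s) m y
        fun v hv => mem_range_cliqueEmbedding s hv
      have hxc : ((fullSimplex d).carrier m x).card = d + 1 := by
        rw [← hy, ← hx, carrier_subdivisionEmbedding, Finset.card_map]
      exact ⟨.inl (⟨x, hxc⟩, s), hx⟩
    · exact ⟨.inr ⟨y, hy⟩, rfl⟩

theorem carrier_copiesEquiv (m : ℕ) (x : (interior d m).V)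
    (s : {s : Finset G.V // G.graph.IsNClique (d + 1) s}) :
    G.carrier m (copiesEquiv G d m (.inl (x, s))) = s.1 :=
  (carrier_subdivisionEmbedding (cliqueEmbedding s) m x.1).trans (map_cliqueEmbedding s x.2)

theorem interiorEdges_copiesEquiv
    (hG : ∀ s : Finset G.V, G.graph.IsClique (s : Set G.V) → s.card ≤ d + 1) (m : ℕ)
    (x y : (interior d m).V) (s t : {s : Finset G.V // G.graph.IsNClique (d + 1) s}) :
    (interiorEdges G d m).Adj (copiesEquiv G d m (.inl (x, s))) (copiesEquiv G d m (.inl (y, t)))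
      ↔ s = t ∧ (interior d m).graph.Adj x y := by
  have hx := carrier_copiesEquiv m x s
  have hy := carrier_copiesEquiv m y t
  constructor
  · rintro ⟨h, h1, h2⟩
    have hst : s = t := Subtype.ext (by rw [← hx, ← hy, carrier_eq_of_adj hG h h1 h2])
    subst hst
    exact ⟨rfl, (subdivisionEmbedding (cliqueEmbedding s) m).map_rel_iff.1 h⟩
  · rintro ⟨rfl, h⟩
    exact ⟨(subdivisionEmbedding (cliqueEmbedding s) m).map_rel_iff.2 h,
      by rw [hx, s.2.card_eq], by rw [hy, s.2.card_eq]⟩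

end Copies

/-! ### The rate of convergence -/

section Rate

open scoped Classical

variable {G : FiniteGraph.{u}} {d : ℕ}

/-- The rate of the `L¹` convergence of the spectral functions. -/
noncomputable def convergenceRate (d : ℕ) : ℝ :=
  ((d + 1).factorial + 1 / 4) * ((d * d.factorial : ℕ) + 1 / 4)
    / ((d + 1).factorial * (d + 1).factorial)

theorem convergenceRate_pos (d : ℕ) : 0 < convergenceRate d := by
  have : 0 < (d + 1).factorial := Nat.factorial_pos _
  rw [convergenceRate]
  positivity

/-- With `A = (d + 1)!` and `d * d! ≤ A - 1`, the numerator is at most `(A + 1/4) * (A - 3/4)`,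
which is less than `A * A`. -/
theorem convergenceRate_lt_one (d : ℕ) : convergenceRate d < 1 := by
  have h1 : (1 : ℝ) ≤ (d + 1).factorial := by exact_mod_cast Nat.factorial_pos _
  have h2 : ((d * d.factorial : ℕ) : ℝ) + 1 ≤ (d + 1).factorial := by
    have : d * d.factorial + 1 ≤ (d + 1).factorial := by
      rw [Nat.factorial_succ, add_mul, one_mul]
      exact Nat.add_le_add_left (Nat.factorial_pos d) _
    exact_mod_cast this
  rw [convergenceRate, div_lt_one (by positivity)]
  nlinarith

theorem order_subdivision_pos (hG' : ∃ s : Finset G.V, G.graph.IsNClique (d + 1) s) (m : ℕ) :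
    0 < (G.subdivision m).order := by
  have h := (factorial_pow_le_card hG' m).trans_lt' (Nat.pos_of_ne_zero
    (pow_ne_zero m (Nat.factorial_ne_zero (d + 1))))
  obtain ⟨s, -⟩ := Finset.card_pos.1 h
  obtain ⟨x, -⟩ := s.2.1
  exact Fintype.card_pos_iff.2 ⟨x⟩

/-- A simplex with `d + 1` vertices in one refinement is a vertex of the next whose carrier has full
size, hence an interior vertex. -/
theorem factorial_pow_le_interior
    (hG : ∀ s : Finset G.V, G.graph.IsClique (s : Set G.V) → s.card ≤ d + 1)
    (hG' : ∃ s : Finset G.V, G.graph.IsNClique (d + 1) s) (m : ℕ) :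
    (d + 1).factorial ^ m ≤ Fintype.card {s : Finset G.V // G.graph.IsNClique (d + 1) s}
      * (interior d (m + 1)).order := by
  refine (factorial_pow_le_card hG' m).trans ?_
  rw [order, mul_comm, ← Fintype.card_prod, ← Finset.card_univ]
  refine Finset.card_le_card_of_surjOn
    (fun p => copiesEquiv G d (m + 1) (.inl p)) fun s hs => ?_
  have hs' : s.1.card = d + 1 := by simpa using hs
  have hcard : (G.carrier (m + 1) s).card = d + 1 :=
    le_antisymm (hG _ (carrier_isClique (m + 1) s))
      (hs'.ge.trans ((G.isCarrier_carrier m).card_le s))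
  rcases h : (copiesEquiv G d (m + 1)).symm s with p | z
  · exact ⟨p, by simp, ((copiesEquiv G d (m + 1)).symm_apply_eq.1 h).symm⟩
  · refine absurd hcard ?_
    have : z.1 = s := ((copiesEquiv G d (m + 1)).symm_apply_eq.1 h).symm
    rw [← this]
    exact z.2

/-- After a refinement the spectral function is, up to an exponentially small error in `L¹`, the
one of the interior of a single simplex. -/
theorem eLpNorm_subdivision_sub_interior_le
    (hG : ∀ s : Finset G.V, G.graph.IsClique (s : Set G.V) → s.card ≤ d + 1)
    (hG' : ∃ s : Finset G.V, G.graph.IsNClique (d + 1) s) :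
    ∃ C : ℝ, 0 ≤ C ∧ ∀ m, eLpNorm ((G.subdivision (m + 1)).spectralFunction
      - (interior d (m + 1)).spectralFunction) 1 μ₁ ≤ ENNReal.ofReal (C * convergenceRate d ^ m) := by
  have hM := one_le_weightBase d
  have hM0 := zero_le_one.trans hM
  let A : ℝ := (d + 1).factorial
  let μ : ℝ := (d * d.factorial : ℕ) + 1 / 4
  let T : ℝ := G.totalWeight (weightBase d)
  let B : ℝ := boundaryWeight (G.carrier 1) (d + 1) (weightBase d)
  have hA : 0 < A := by simpa [A] using Nat.factorial_pos (d + 1)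
  have hμ : 0 < μ := by positivity
  have hT : 0 ≤ T := Finset.sum_nonneg fun _ _ => pow_nonneg hM0 _
  have hB : 0 ≤ B := Finset.sum_nonneg fun _ _ => pow_nonneg hM0 _
  have hρ := convergenceRate_pos d
  have hρeq : convergenceRate d = (A + 1 / 4) * μ / (A * A) := rfl
  -- The first term accounts for the deleted edges, the second for the isolated vertices.
  refine ⟨2 * B + 2 * (T * (A + 1 / 4)) * B, by positivity, fun m => ?_⟩
  have : Nonempty {s : Finset G.V // G.graph.IsNClique (d + 1) s} := by
    obtain ⟨s, hs⟩ := hG'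
    exact ⟨⟨s, hs⟩⟩
  have hint := factorial_pow_le_interior hG hG' m
  have hI : 0 < (interior d (m + 1)).order :=
    Nat.pos_of_mul_pos_left (hint.trans_lt' (pow_pos (Nat.factorial_pos _) m))
  refine (eLpNorm_spectralFunction_sub_le (H := G.subdivision (m + 1)) hI
    (G' := interiorEdges G d (m + 1)) (fun x y h => h.1) (copiesEquiv G d (m + 1))
    (interiorEdges_copiesEquiv hG (m + 1)) (fun z v h => z.2 h.2.1)).trans
    (ENNReal.ofReal_le_ofReal ?_)
  set n : ℝ := ((G.subdivision (m + 1)).order : ℝ)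
  set k : ℝ := (Fintype.card {s : Finset G.V // G.graph.IsNClique (d + 1) s} : ℝ)
    * (interior d (m + 1)).order
  have hk : A ^ m ≤ k := by
    simp only [A, k]
    exact_mod_cast hint
  have hn : A ^ m ≤ n := by
    refine hk.trans ?_
    have := order_eq_of_copies (copiesEquiv G d (m + 1))
    simp only [k, n]
    rw [this]
    push_cast
    exact le_add_of_nonneg_right (Nat.cast_nonneg _)
  have hbd := boundaryWeight_subdivision_le hG m
  have he1 : (((G.subdivision (m + 1)).graph.edgeSet \ (interiorEdges G d (m + 1)).edgeSet).ncard : ℝ)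
      ≤ B * μ ^ m := by
    refine (ncard_le_sum_pow hM (P := Touches (G.carrier (m + 1)) (d + 1)) ?_).trans hbd
    rintro x y ⟨h1, h2⟩
    refine ⟨h1, ?_⟩
    have hx := hG _ (carrier_isClique (m + 1) x)
    have hy := hG _ (carrier_isClique (m + 1) y)
    by_cases hx' : (G.carrier (m + 1) x).card = d + 1
    · have hy' : (G.carrier (m + 1) y).card ≠ d + 1 := fun hy' => h2 ⟨h1, hx', hy'⟩
      exact ⟨y, Finset.mem_insert_of_mem (Finset.mem_singleton_self _), by omega⟩
    · exact ⟨x, Finset.mem_insert_self _ _, by omega⟩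
  have he2 : (Fintype.card {x : (G.subdivision (m + 1)).V // (G.carrier (m + 1) x).card ≠ d + 1} : ℝ)
      ≤ B * μ ^ m := by
    refine (card_le_sum_pow hM (P := Touches (G.carrier (m + 1)) (d + 1)) Subtype.val
      Subtype.val_injective ?_).trans hbd
    intro z
    have hz := hG _ (carrier_isClique (m + 1) z.1)
    have hz' := z.2
    exact ⟨z.1, Finset.mem_singleton_self _, by omega⟩
  have he3 : ((G.subdivision (m + 1)).graph.edgeSet.ncard : ℝ) ≤ T * (A + 1 / 4) ^ (m + 1) := by
    refine le_trans ?_ (totalWeight_subdivision_le hG (m + 1))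
    have h := ncard_le_sum_pow (H := G.subdivision (m + 1)) hM (P := fun _ => True)
      (E := (G.subdivision (m + 1)).graph.edgeSet) fun x y h => ⟨h, trivial⟩
    simpa [totalWeight] using h
  have hAm : 0 < A ^ m := pow_pos hA m
  -- Deleted edges alone decay at the rate `μ / A`. The isolated vertices are multiplied by the
  -- average degree, whose bound may grow like `((A + 1/4) / A) ^ m`; this sets the final rate.
  have hμρ : μ / A ≤ convergenceRate d := by
    rw [hρeq, div_le_div_iff₀ hA (by positivity)]
    nlinarith [mul_pos hμ hA]
  have hb1 : 2 * (((G.subdivision (m + 1)).graph.edgeSet \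
      (interiorEdges G d (m + 1)).edgeSet).ncard : ℝ) / n ≤ 2 * B * convergenceRate d ^ m := by
    calc _ ≤ 2 * (B * μ ^ m) / A ^ m := by gcongr
      _ = 2 * B * (μ / A) ^ m := by rw [div_pow]; ring
      _ ≤ _ := by gcongr
  have hb2 : 2 * ((G.subdivision (m + 1)).graph.edgeSet.ncard : ℝ) * (Fintype.card
      {x : (G.subdivision (m + 1)).V // (G.carrier (m + 1) x).card ≠ d + 1} : ℝ) / (n * k)
      ≤ 2 * (T * (A + 1 / 4)) * B * convergenceRate d ^ m := by
    calc _ ≤ 2 * (T * (A + 1 / 4) ^ (m + 1)) * (B * μ ^ m) / (A ^ m * A ^ m) := by gcongr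
      _ = _ := by
        rw [hρeq, div_pow, mul_pow, mul_pow, pow_succ]
        ring
  rw [add_mul]
  exact add_le_add hb1 hb2

end Rate

end FiniteGraph

/-! ### The universal limit and the main theorem -/

theorem eLpNorm_sub_le_add {f g h : ℝ → ℝ} (hf : AEStronglyMeasurable f μ₁)
    (hg : AEStronglyMeasurable g μ₁) (hh : AEStronglyMeasurable h μ₁) {a b : ℝ} (ha : 0 ≤ a)
    (hb : 0 ≤ b) (hfg : eLpNorm (f - g) 1 μ₁ ≤ ENNReal.ofReal a)
    (hgh : eLpNorm (g - h) 1 μ₁ ≤ ENNReal.ofReal b) :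
    eLpNorm (f - h) 1 μ₁ ≤ ENNReal.ofReal (a + b) := by
  rw [← sub_add_sub_cancel f g h, ENNReal.ofReal_add ha hb]
  exact (eLpNorm_add_le (hf.sub hg) (hg.sub hh) le_rfl).trans (add_le_add hfg hgh)

namespace FiniteGraph

theorem order_interior_pos (d m : ℕ) : 0 < (interior d (m + 1)).order := by
  have hG : ∀ s : Finset (fullSimplex d).V,
      (fullSimplex d).graph.IsClique (s : Set (fullSimplex d).V) → s.card ≤ d + 1 := fun s _ =>
    (Finset.card_le_univ s).trans_eq (Fintype.card_fin _)
  have hG' : ∃ s, (fullSimplex d).graph.IsNClique (d + 1) s :=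
    ⟨Finset.univ, fun _ _ _ _ h => h, Fintype.card_fin _⟩
  exact Nat.pos_of_mul_pos_left ((factorial_pow_le_interior hG hG' m).trans_lt'
    (pow_pos (Nat.factorial_pos _) m))

/-- The spectral functions of the interiors of the refined simplices form a Cauchy sequence. -/
theorem exists_eLpNorm_interior_sub_le (d : ℕ) :
    ∃ C : ℝ, 0 ≤ C ∧ ∀ m, eLpNorm ((interior d (m + 2)).spectralFunction
      - (interior d (m + 1)).spectralFunction) 1 μ₁ ≤ ENNReal.ofReal (C * convergenceRate d ^ m) := by
  have hG : ∀ s : Finset (fullSimplex d).V,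
      (fullSimplex d).graph.IsClique (s : Set (fullSimplex d).V) → s.card ≤ d + 1 := fun s _ =>
    (Finset.card_le_univ s).trans_eq (Fintype.card_fin _)
  have hG' : ∃ s, (fullSimplex d).graph.IsNClique (d + 1) s :=
    ⟨Finset.univ, fun _ _ _ _ h => h, Fintype.card_fin _⟩
  have hR : ∀ s : Finset (fullSimplex d).refine.V,
      (fullSimplex d).refine.graph.IsClique (s : Set (fullSimplex d).refine.V) →
        s.card ≤ d + 1 := by
    intro s hs
    rcases s.eq_empty_or_nonempty with rfl | hne
    · simp
    · exact card_simplex_le hG 1 ⟨s, hne, hs⟩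
  have hR' : ∃ s, (fullSimplex d).refine.graph.IsNClique (d + 1) s := by
    have h := (factorial_pow_le_card hG' 1).trans_lt' (pow_pos (Nat.factorial_pos (d + 1)) 1)
    obtain ⟨s, hs⟩ := Finset.card_pos.1 h
    exact ⟨s.1, s.2.2, (Finset.mem_filter.1 hs).2⟩
  -- The `(m + 2)`-th refinement of the simplex is also the `(m + 1)`-th refinement of its first
  -- refinement. So one graph is compared with both `interior d (m + 2)` and `interior d (m + 1)`.
  obtain ⟨C₁, hC₁, h₁⟩ := eLpNorm_subdivision_sub_interior_le hG hG'
  obtain ⟨C₂, hC₂, h₂⟩ := eLpNorm_subdivision_sub_interior_le hR hR'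
  have hρ := convergenceRate_pos d
  refine ⟨C₁ * convergenceRate d + C₂, by positivity, fun m => ?_⟩
  have h1 := h₁ (m + 1)
  have h2 := h₂ m
  rw [subdivision_refine] at h2
  rw [eLpNorm_sub_comm] at h1
  have hm : ∀ H : FiniteGraph.{0}, 0 < H.order → AEStronglyMeasurable H.spectralFunction μ₁ :=
    fun H hH => ((H.monotone_spectralFunction hH).monotoneOn _).aestronglyMeasurable_unit
  refine (eLpNorm_sub_le_add (hm _ (order_interior_pos d (m + 1)))
    (hm _ (order_subdivision_pos hG' (m + 2))) (hm _ (order_interior_pos d m))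
    (by positivity) (by positivity) h1 h2).trans_eq ?_
  rw [pow_succ]
  ring_nf

/-- The limit of the spectral functions of the refinements of a simplex. -/
theorem exists_limit (d : ℕ) :
    ∃ F : ℝ → ℝ, MemLp F 1 μ₁ ∧ MonotoneOn F (Ico 0 1) ∧ F 0 = 0 ∧
      ∃ C : ℝ, 0 ≤ C ∧ ∀ m, eLpNorm ((interior d (m + 1)).spectralFunction - F) 1 μ₁
        ≤ ENNReal.ofReal (C * convergenceRate d ^ m) := by
  obtain ⟨C, hC, h⟩ := exists_eLpNorm_interior_sub_le d
  obtain ⟨F, hF, hFm, hF0, hb⟩ := exists_monotoneOn_limit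
    (f := fun m => (interior d (m + 1)).spectralFunction)
    (fun m => (monotone_spectralFunction _ (order_interior_pos d m)).monotoneOn _)
    (fun m => spectralFunction_zero _ (order_interior_pos d m)) hC (convergenceRate_pos d).le
    (convergenceRate_lt_one d) h
  exact ⟨F, hF, hFm, hF0, _, div_nonneg hC (sub_nonneg.2 (convergenceRate_lt_one d).le), hb⟩

theorem exists_eLpNorm_subdivision_sub_le {d : ℕ} {F : ℝ → ℝ} (hF : MemLp F 1 μ₁) {C : ℝ}
    (hC : 0 ≤ C) (hb : ∀ m, eLpNorm ((interior d (m + 1)).spectralFunction - F) 1 μ₁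
      ≤ ENNReal.ofReal (C * convergenceRate d ^ m)) {G : FiniteGraph.{u}}
    (hG : ∀ s : Finset G.V, G.graph.IsClique (s : Set G.V) → s.card ≤ d + 1)
    (hG' : ∃ s : Finset G.V, G.graph.IsNClique (d + 1) s) :
    ∃ C : ℝ, 0 ≤ C ∧ ∀ m, eLpNorm ((G.subdivision m).spectralFunction - F) 1 μ₁
      ≤ ENNReal.ofReal (C * convergenceRate d ^ m) := by
  obtain ⟨C₁, hC₁, h₁⟩ := eLpNorm_subdivision_sub_interior_le hG hG'
  have hρ := convergenceRate_pos d
  have hm : ∀ m, MonotoneOn (G.subdivision m).spectralFunction (Icc 0 1) := fun m =>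
    (monotone_spectralFunction _ (order_subdivision_pos hG' m)).monotoneOn _
  let c := (eLpNorm ((G.subdivision 0).spectralFunction - F) 1 μ₁).toReal
  have hc : 0 ≤ c := ENNReal.toReal_nonneg
  -- The summand `c` covers `m = 0`, where no comparison with an interior is available; dividing by
  -- the rate makes up for the index shift in the other cases.
  refine ⟨c + (C₁ + C) / convergenceRate d, by positivity, fun m => ?_⟩
  rcases m with _ | m
  · rw [pow_zero, mul_one, ENNReal.ofReal_add hc (by positivity)]
    refine le_trans ?_ le_self_add
    rw [ENNReal.ofReal_toReal ((hm 0).memLp_unit.sub hF).2.ne]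
  · have hi : MonotoneOn (interior d (m + 1)).spectralFunction (Icc 0 1) :=
      (monotone_spectralFunction _ (order_interior_pos d m)).monotoneOn _
    refine (eLpNorm_sub_le_add (hm _).aestronglyMeasurable_unit
      hi.aestronglyMeasurable_unit hF.1 (by positivity) (by positivity) (h₁ m) (hb m)).trans
      (ENNReal.ofReal_le_ofReal ?_)
    rw [pow_succ, add_mul]
    have h0 : 0 ≤ c * (convergenceRate d ^ m * convergenceRate d) := by positivity
    have h1 : (C₁ + C) / convergenceRate d * (convergenceRate d ^ m * convergenceRate d)
        = C₁ * convergenceRate d ^ m + C * convergenceRate d ^ m := by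
      field_simp
    linarith

end FiniteGraph

theorem mainTheorem1 :
    ∀ d : ℕ, ∃ (F : ℝ → ℝ) (ρ : ℝ),
      -- the limit is integrable, increasing on `[0,1)`, and starts at `0`
      MemLp F 1 (volume.restrict (Icc (0 : ℝ) 1)) ∧
      MonotoneOn F (Ico (0 : ℝ) 1) ∧ F 0 = 0 ∧
      0 < ρ ∧ ρ < 1 ∧
      -- `F` and `ρ` serve all finite simple graphs whose largest complete subgraph has dimension `d`
      ∀ (V : Type u) (instV : Fintype V) (G : SimpleGraph V), G.cliqueNum = d + 1 →
        let f : ℕ → ℝ → ℝ := fun m =>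
          ((FiniteGraph.mk V instV G).iterRefine m).spectralFunction
        -- convergence in `L^1([0,1])`
        Tendsto (fun m => eLpNorm (f m - F) 1 (volume.restrict (Icc (0 : ℝ) 1))) atTop (𝓝 0) ∧
        -- exponentially fast
        (∃ C : ℝ, ∀ m : ℕ,
          eLpNorm (f m - F) 1 (volume.restrict (Icc (0 : ℝ) 1)) ≤ ENNReal.ofReal (C * ρ ^ m)) ∧
        -- uniform convergence on compact sets of continuity points of the limit
        (∀ K : Set ℝ, IsCompact K → K ⊆ Ico (0 : ℝ) 1 →
          (∀ x ∈ K, ContinuousWithinAt F (Ico (0 : ℝ) 1) x) →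
          TendstoUniformlyOn f F atTop K) ∧
        -- exponentially fast in the supremum norm on compact intervals around which the limit
        -- is Hölder continuous
        (∀ a' a b b' : ℝ, 0 < a' → a' < a → a ≤ b → b < b' → b' < 1 →
          (∃ H α : ℝ≥0, 0 < α ∧ HolderOnWith H α F (Icc a' b')) →
          ∃ C σ : ℝ, 0 < σ ∧ σ < 1 ∧
            ∀ m : ℕ, ∀ x ∈ Icc a b, |f m x - F x| ≤ C * σ ^ m) := by
  intro d
  obtain ⟨F, hF, hFm, hF0, C₀, hC₀, hb⟩ := FiniteGraph.exists_limit d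
  have hρ := FiniteGraph.convergenceRate_pos d
  have hρ1 := FiniteGraph.convergenceRate_lt_one d
  refine ⟨F, FiniteGraph.convergenceRate d, hF, hFm, hF0, hρ, hρ1, ?_⟩
  intro V instV G hcl f
  have hG : ∀ s : Finset V, G.IsClique (s : Set V) → s.card ≤ d + 1 := fun s hs => by
    rw [← hcl]
    exact SimpleGraph.IsClique.card_le_cliqueNum (tc := hs)
  have hG' : ∃ s : Finset V, G.IsNClique (d + 1) s := by
    rw [← hcl]
    exact G.exists_isNClique_cliqueNum
  obtain ⟨C, hC, h⟩ := FiniteGraph.exists_eLpNorm_subdivision_sub_le hF hC₀ hb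
    (G := ⟨V, instV, G⟩) hG hG'
  have hf : ∀ m, f m = (FiniteGraph.subdivision ⟨V, instV, G⟩ m).spectralFunction := fun m => by
    simp only [f, FiniteGraph.iterRefine_eq_subdivision]
  have hpos := fun m => FiniteGraph.order_subdivision_pos (G := ⟨V, instV, G⟩) hG' m
  have hm : ∀ m, MonotoneOn (f m) (Icc 0 1) := fun m => by
    rw [hf]
    exact (FiniteGraph.monotone_spectralFunction _ (hpos m)).monotoneOn _
  have h0 : ∀ m, f m 0 = 0 := fun m => by
    rw [hf]
    exact FiniteGraph.spectralFunction_zero _ (hpos m)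
  have hle : ∀ m, eLpNorm (f m - F) 1 (volume.restrict (Icc (0 : ℝ) 1))
      ≤ ENNReal.ofReal (C * FiniteGraph.convergenceRate d ^ m) := fun m => by
    rw [hf]
    exact h m
  have hlim : Tendsto (fun m => C * FiniteGraph.convergenceRate d ^ m) atTop (𝓝 0) := by
    simpa using (tendsto_pow_atTop_nhds_zero_of_lt_one hρ.le hρ1).const_mul C
  refine ⟨?_, ⟨C, hle⟩, ?_, ?_⟩
  · refine tendsto_of_tendsto_of_tendsto_of_le_of_le tendsto_const_nhds ?_ (fun _ => zero_le) hle
    simpa using ENNReal.tendsto_ofReal hlim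
  · intro K hK hK1 hc
    exact tendstoUniformlyOn_of_monotoneOn hm h0 hF hF0 (fun m => by positivity) hlim hle hK hK1 hc
  · rintro a' a b b' ha' haa - hbb hb' ⟨H, α, hα, hH⟩
    exact exists_geometric_bound_of_holderOnWith hm hF hC hρ hρ1 hle ha' haa hbb hb' hα hH
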